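/- **Groupoids and bundles.** For a groupoid $G$ (viewed as its set of arrows) write $\mathsf s(g)=g^{-1}g$, $\mathsf r(g)=gg^{-1}$ and $G^0=\{g: gg=g\}$; the product $gh$ is defined iff $\mathsf s(g)=\mathsf r(h)$. A slice is a subset of $G$ on which $\mathsf s$ and $\mathsf r$ are injective. A topological groupoid has continuous inverse and product; it is étale if $\mathsf s:G\to G$ is moreover an open map. A groupoid bundle is an open continuous functor $\pi:F\to G$, injective on units, from a topological groupoid $F$ to an étale groupoid $G$. A slice-section of $\pi$ is a continuous map $a:\mathrm{dom}(a)\to F$ with $\pi\circ a=\mathrm{id}$, where $\mathrm{dom}(a)\subseteq G$ is an open slice; the set $\mathcal S(\pi)$ of slice-sections is a semigroup under $(ab)(gh)=a(g)b(h)$, with $\mathrm{dom}(ab)=\mathrm{dom}(a)\,\mathrm{dom}(b)$. A relation $\varphi\subseteq G\times H$ between étale groupoids (we write $g\,\varphi\,h$) is a Zakrzewski morphism if it is (i) functorial: $g\,\varphi\,h\Rightarrow g^{-1}\,\varphi\,h^{-1}$; and if $g\,\varphi\,h$, $g'\,\varphi\,h'$ and $\mathsf s(h)=\mathsf r(h')$,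 then $\mathsf s(g)=\mathsf r(g')$ and $gg'\,\varphi\,hh'$; (ii) star-bijective: if $h\in H^0$ and $\mathsf r(g)\,\varphi\,h$, there is exactly one $i\in H$ with $\mathsf r(i)=h$ and $g\,\varphi\,i$; (iii) continuous: $\varphi^{-1}[O]=\{h:\exists g\in O\ (g\,\varphi\,h)\}$ is open for every open $O\subseteq G$. A Zakrzewski–Pierce morphism from a groupoid bundle $\pi:F\to G$ to a groupoid bundle $\pi':F'\to G'$ is a pair $(\varphi,\tau)$ where $\varphi\subseteq G\times G'$ is a Zakrzewski morphism and $\tau$ is a continuous functor to $F'$ from $\varphi^\pi F=\{(f,g')\in F\times G':\pi(f)\,\varphi\,g'\}$ (with the subspace topology and coordinatewise product) such that $\pi'(\tau(f,g'))=g'$. It induces $\frac{\tau}{\varphi}:\mathcal S(\pi)\to\mathcal S(\pi')$, where $\mathrm{dom}(\frac{\tau}{\varphi}(a))=\varphi^{-1}[\mathrm{dom}(a)]$ and $\frac{\tau}{\varphi}(a)(g')=\tau(a(g),g')$ for the unique $g\in\mathrm{dom}(a)$ with $g\,\varphi\,g'$. **Structured semigroups.** A structured semigroup $(S,N,Z)$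 is a semigroup $S$ with subsemigroups $Z\subseteq N\subseteq S$ such that $zn=nz$ for all $z\in Z$, $n\in N$, and such that for all $a,b\in S$ with $ab,ba\in Z$ we have $aZb\cup bZa\subseteq Z$ and, for every $n\in N$ with $abn=n=nab$, also $bna\in N$. Write $a<_s b$ if $asb=a=bsa$, $as,sa\in N$ and $bs,sb\in Z$; write $a<b$ if $a<_sb$ for some $s\in S$. For $A\subseteq S$ put $A^<=\{b:\exists a\in A\ (a<b)\}$ and $A^*=\{s:\exists a\in A\ \exists b\in S\ (a<_sb)\}$. Call $Z$ symmetric if $ab\in Z$ implies $baba\in Z$, for all $a,b\in S$. A bundle representation of $(S,N,Z)$ on a groupoid bundle $\pi:F\to G$ is a semigroup homomorphism $\theta:S\to\mathcal S(\pi)$ such that the sets $\mathrm{dom}(\theta(a))$, $a\in S$, cover $G$, $\mathrm{dom}(\theta(n))\subseteq G^0$ for all $n\in N$, and whenever $g\in\mathrm{dom}(\theta(a))$ there is $b<a$ with $g\in\mathrm{dom}(\theta(b))$. **The directed coset bundle.** The coset groupoid $\mathcal C(S)$ consists of all non-empty $C\subseteq S$ with $CC^*C\subseteq C=C^<$. The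 inverse of $C$ is $C^*$ and the product is $B\cdot C=(BC)^<$, defined when $(B^*B)^<=(CC^*)^<$. Its topology is generated by the sets $\mathcal C_a=\{C\in\mathcal C(S):a\in C\}$, $a\in S$. For $a,b\in C\in\mathcal C(S)$ let $a\sim_C b$ mean that $sat=sbt$ for some $s,t\in C^*$; this is an equivalence relation on $C$. Let $[a,C]$ be the pair consisting of the $\sim_C$-class of $a$ and $C$. The set $\widetilde{\mathcal C}(S)=\{[c,C]:c\in C\in\mathcal C(S)\}$ is a groupoid under $[a,A][b,B]=[ab,A\cdot B]$ (when $A\cdot B$ is defined), and its topology is generated by the sets $\{[s,C]:s\in C\in\mathcal C(S)\}$ and $\{[c,C]:c,s\in C\in\mathcal C(S)\}$, $s\in S$. Let $\mathcal D(S)$ be the subgroupoid of those $D\in\mathcal C(S)$ that are directed (for all $a,b\in D$ there is $d\in D$ with $d<a$ and $d<b$), let $\widetilde{\mathcal D}(S)=\{[d,D]:d\in D\in\mathcal D(S)\}$, both with the subspace topologies, and let $\rho_{\mathcal D}:\widetilde{\mathcal D}(S)\to\mathcal D(S)$, $[d,D]\mapsto D$. For $a\in S$ let $\tilde a_{\mathcal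 D}$ be the map $D\mapsto[a,D]$ with domain $\mathcal D_a=\{D\in\mathcal D(S):a\in D\}$. **Theorem.** Let $(S,N,Z)$ be a structured semigroup with $Z$ symmetric. Then $\rho_{\mathcal D}$ is a groupoid bundle, and $\widetilde{\mathcal D}:a\mapsto\tilde a_{\mathcal D}$ is a bundle representation of $(S,N,Z)$ on $\rho_{\mathcal D}$ which is Zakrzewski-universal: for every bundle representation $\theta$ of $(S,N,Z)$ on a groupoid bundle $\pi:F\to G$ there is a unique Zakrzewski–Pierce morphism $(\varphi,\tau)$ from $\rho_{\mathcal D}$ to $\pi$ such that $\theta=\frac{\tau}{\varphi}\circ\widetilde{\mathcal D}$. -/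

import Mathlib

open scoped Pointwise

universe u v w

/-- A groupoid, as a set of arrows with a partial product: `mul g h` is defined when the source of
`g` is the range of `h`, and every arrow `g` has an inverse with `g⁻¹ g = src g`, `g g⁻¹ = rng g`. -/
class ArrowGroupoid (G : Type*) where
  src : G → G
  rng : G → G
  mul : ∀ g h : G, src g = rng h → G
  inv : G → G
  rng_src : ∀ g, rng (src g) = src g
  src_rng : ∀ g, src (rng g) = rng g
  src_mul : ∀ g h e, src (mul g h e) = src h
  rng_mul : ∀ g h e, rng (mul g h e) = rng g
  mul_src : ∀ g, mul g (src g) (rng_src g).symm = g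
  rng_mul_self : ∀ g, mul (rng g) g (src_rng g) = g
  mul_assoc : ∀ (g h k : G) (e₁ : src g = rng h) (e₂ : src h = rng k),
    mul (mul g h e₁) k ((src_mul g h e₁).trans e₂) = mul g (mul h k e₂) (e₁.trans (rng_mul h k e₂).symm)
  src_inv : ∀ g, src (inv g) = rng g
  rng_inv : ∀ g, rng (inv g) = src g
  inv_mul : ∀ g, mul (inv g) g (src_inv g) = src g
  mul_inv : ∀ g, mul g (inv g) (rng_inv g).symm = rng g

theorem ArrowGroupoid.inv_eq_of_src {G : Type*} [ArrowGroupoid G] {g : G} (h : src g = g) :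
    inv g = g := by
  have key : ∀ x (_ : src (inv g) = x) (e : src (inv g) = rng x), mul (inv g) x e = inv g := by
    rintro _ rfl _; exact mul_src _
  have h1 : src (inv g) = g := by rw [src_inv, ← h, rng_src]
  rw [← key g h1 (src_inv g), inv_mul, h]

namespace ArrowGroupoid

section Algebra

variable {F G H : Type*} [ArrowGroupoid F] [ArrowGroupoid G] [ArrowGroupoid H]

/-- The product `g h` is defined and equal to `k`. -/
def IsMul (g h k : G) : Prop := ∃ e : src g = rng h, mul g h e = k

/-- The set `G⁰ = {g | g g = g}` of units. -/
def units (G : Type*) [ArrowGroupoid G] : Set G := {g | IsMul g g g}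

/-- A slice (or bisection) is a set on which the source and range maps are injective. -/
def IsSlice (B : Set G) : Prop := Set.InjOn src B ∧ Set.InjOn rng B

/-- The product `A B = {g h | g ∈ A, h ∈ B, g h is defined}`. -/
def setMul (A B : Set G) : Set G := {k | ∃ g ∈ A, ∃ h ∈ B, IsMul g h k}

/-- A subset of a groupoid which is closed under inverses and products is a groupoid. -/
@[reducible] def restrict (P : G → Prop) (hinv : ∀ g, P g → P (inv g))
    (hmul : ∀ g h e, P g → P h → P (mul g h e)) : ArrowGroupoid {g // P g} where
  src g := ⟨src g.1, inv_mul g.1 ▸ hmul _ _ _ (hinv _ g.2) g.2⟩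
  rng g := ⟨rng g.1, mul_inv g.1 ▸ hmul _ _ _ g.2 (hinv _ g.2)⟩
  mul g h e := ⟨mul g.1 h.1 (congrArg Subtype.val e), hmul _ _ _ g.2 h.2⟩
  inv g := ⟨inv g.1, hinv _ g.2⟩
  rng_src g := Subtype.ext (rng_src g.1)
  src_rng g := Subtype.ext (src_rng g.1)
  src_mul g h _ := Subtype.ext (src_mul g.1 h.1 _)
  rng_mul g h _ := Subtype.ext (rng_mul g.1 h.1 _)
  mul_src g := Subtype.ext (mul_src g.1)
  rng_mul_self g := Subtype.ext (rng_mul_self g.1)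
  mul_assoc g h k e₁ e₂ :=
    Subtype.ext (mul_assoc g.1 h.1 k.1 (congrArg Subtype.val e₁) (congrArg Subtype.val e₂))
  src_inv g := Subtype.ext (src_inv g.1)
  rng_inv g := Subtype.ext (rng_inv g.1)
  inv_mul g := Subtype.ext (inv_mul g.1)
  mul_inv g := Subtype.ext (mul_inv g.1)

/-- A functor between groupoids preserves products. -/
def IsFunctor (π : F → G) : Prop := ∀ g h k, IsMul g h k → IsMul (π g) (π h) (π k)

/-- The preimage `φ⁻¹[A]` of `A ⊆ G` under the relation `φ ⊆ G × H`, viewed as a relation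
from `H` to `G`. -/
def relPreimage {G H : Type*} (φ : G → H → Prop) (A : Set G) : Set H := {h | ∃ g ∈ A, φ g h}

/-- The domain of the relation `φ ⊆ G × H`. -/
def relDom {G H : Type*} (φ : G → H → Prop) : Set H := relPreimage φ Set.univ

/-- Functorial relations `φ ⊆ G × H`. -/
structure IsFunctorial (φ : G → H → Prop) : Prop where
  inv : ∀ g h, φ g h → φ (inv g) (inv h)
  mul : ∀ g h g' h', φ g h → φ g' h' → ∀ e : src h = rng h',
    ∃ e' : src g = rng g', φ (mul g g' e') (mul h h' e)

/-- Star-bijectivity: if `rng g φ h` for a unit `h`, then there is precisely one `i` with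
`rng i = h` and `g φ i`. -/
def IsStarBijective (φ : G → H → Prop) : Prop :=
  ∀ g h, h ∈ units H → φ (rng g) h → ∃! i, rng i = h ∧ φ g i

/-- The product of sections given by their graphs: `(a b) (g h) = a g · b h`, for `g ∈ dom a`,
`h ∈ dom b` such that `g h` is defined. -/
def sectionMul (a b : F → G → Prop) : F → G → Prop :=
  fun x k => ∃ f g f' h, a f g ∧ b f' h ∧ IsMul g h k ∧ IsMul f f' x

end Algebra

section Topology

variable {F G H : Type*} [TopologicalSpace F] [ArrowGroupoid F] [TopologicalSpace G]
  [ArrowGroupoid G] [TopologicalSpace H] [ArrowGroupoid H]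

/-- Topological groupoids: the inverse and the product are continuous. -/
structure IsTopGroupoid (G : Type*) [TopologicalSpace G] [ArrowGroupoid G] : Prop where
  continuous_inv : Continuous (inv : G → G)
  continuous_mul : Continuous fun p : {p : G × G // src p.1 = rng p.2} => mul p.1.1 p.1.2 p.2

/-- Étale groupoids: topological groupoids with an open source map. -/
structure IsEtale (G : Type*) [TopologicalSpace G] [ArrowGroupoid G] : Prop extends
    IsTopGroupoid G where
  isOpenMap_src : IsOpenMap (src : G → G)

/-- Groupoid bundles: open continuous functors, injective on units, from a topological groupoid to
an étale groupoid. -/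
structure IsGroupoidBundle (π : F → G) : Prop where
  isTopGroupoid : IsTopGroupoid F
  isEtale : IsEtale G
  isFunctor : IsFunctor π
  injOn_units : Set.InjOn π (units F)
  continuous : Continuous π
  isOpenMap : IsOpenMap π

/-- A relation is continuous if preimages of open sets are open. -/
def RelContinuous {G H : Type*} [TopologicalSpace G] [TopologicalSpace H] (φ : G → H → Prop) :
    Prop := ∀ O : Set G, IsOpen O → IsOpen (relPreimage φ O)

/-- Zakrzewski morphisms: continuous star-bijective functorial relations. -/
structure IsZakrzewski (φ : G → H → Prop) : Prop where
  isFunctorial : IsFunctorial φ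
  isStarBijective : IsStarBijective φ
  relContinuous : RelContinuous φ

/-- `a` is (the graph of) a slice-section of `π`: a continuous map, defined on an open slice of `G`,
with `π (a g) = g`. Here `a f g` means that `g` is in the domain of `a` and that `f` is the value of
`a` at `g`; as the domain is open, continuity on the domain says that preimages of open sets are open
in `G`. -/
structure IsSliceSection (π : F → G) (a : F → G → Prop) : Prop where
  unique : ∀ f f' g, a f g → a f' g → f = f'
  isOpen_dom : IsOpen (relDom a)
  isSlice_dom : IsSlice (relDom a)
  relContinuous : RelContinuous a
  proj : ∀ f g, a f g → π f = g

/-- Zakrzewski–Pierce morphisms `(φ, τ)` from `π : F → G` to `π' : F' → G'`: here `rel` is the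
Zakrzewski morphism `φ ⊆ G × G'`, and `map` is the continuous functor `τ` to `F'` from the pullback
`{(f, h) ∈ F × G' | π f φ h}`, which is a groupoid with the coordinatewise product. -/
@[ext] structure ZPMorphism {F G F' G' : Type*} [TopologicalSpace F] [ArrowGroupoid F]
    [TopologicalSpace G] [ArrowGroupoid G] [TopologicalSpace F'] [ArrowGroupoid F']
    [TopologicalSpace G'] [ArrowGroupoid G'] (π : F → G) (π' : F' → G') where
  rel : G → G' → Prop
  map : {p : F × G' // rel (π p.1) p.2} → F'
  isZakrzewski : IsZakrzewski rel
  continuous_map : Continuous map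
  map_functor : ∀ p q w : {p : F × G' // rel (π p.1) p.2}, IsMul p.1.1 q.1.1 w.1.1 →
    IsMul p.1.2 q.1.2 w.1.2 → IsMul (map p) (map q) (map w)
  proj_map : ∀ p, π' (map p) = p.1.2

/-- The section `τ/φ (a)` of `π'` induced by a section `a` of `π`: its value at `h` is
`τ (a g, h)`, for any `g ∈ dom a` with `g φ h`. -/
def ZPMorphism.transport {F G F' G' : Type*} [TopologicalSpace F] [ArrowGroupoid F]
    [TopologicalSpace G] [ArrowGroupoid G] [TopologicalSpace F'] [ArrowGroupoid F']
    [TopologicalSpace G'] [ArrowGroupoid G'] {π : F → G} {π' : F' → G'} (m : ZPMorphism π π')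
    (a : F → G → Prop) : F' → G' → Prop :=
  fun f' h => ∃ (f : F) (e : m.rel (π f) h), (∃ g, a f g ∧ m.rel g h) ∧ f' = m.map ⟨(f, h), e⟩

end Topology

end ArrowGroupoid

/-- A structured semigroup `(S, N, Z)`: `N` is a `Z`-trinormal subsemigroup of `S`, and `Z` is a
binormal subsemigroup of `S` contained in the centre of `N`. -/
structure StructuredSemigroup (S : Type*) [Semigroup S] where
  N : Subsemigroup S
  Z : Subsemigroup S
  Z_le : Z ≤ N
  Z_comm : ∀ z ∈ Z, ∀ n ∈ N, z * n = n * z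
  binormal : ∀ a b : S, a * b ∈ Z → b * a ∈ Z → ∀ z ∈ Z, a * z * b ∈ Z ∧ b * z * a ∈ Z
  trinormal : ∀ a b n : S, n ∈ N → a * b * n = n → n * a * b = n →
    a * b ∈ Z → b * a ∈ Z → b * n * a ∈ N

namespace StructuredSemigroup
variable {S : Type*} [Semigroup S] {T : StructuredSemigroup S}

/-- `a` is dominated by `b` via `s`, written `a <_s b`. -/
structure DomVia (T : StructuredSemigroup S) (s a b : S) : Prop where
  left : a * s * b = a
  right : b * s * a = a
  as_mem : a * s ∈ T.N
  sa_mem : s * a ∈ T.N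
  bs_mem : b * s ∈ T.Z
  sb_mem : s * b ∈ T.Z

/-- Domination: `a < b`. -/
def Dom (T : StructuredSemigroup S) (a b : S) : Prop := ∃ s, T.DomVia s a b
/-- The up-closure `A^<`. -/
def up (T : StructuredSemigroup S) (A : Set S) : Set S := {b | ∃ a ∈ A, T.Dom a b}
/-- The dual `A*`. -/
def dual (T : StructuredSemigroup S) (A : Set S) : Set S := {s | ∃ a ∈ A, ∃ b, T.DomVia s a b}

theorem DomVia.of_left {a s b : S} (h : a * s * b = a) (has : a * s ∈ T.N) (hbs : b * s ∈ T.Z)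
    (hsb : s * b ∈ T.Z) : T.DomVia s a b := by
  have hc := T.Z_comm _ hbs _ has
  have h2 : b * s * a = a := by grind
  refine ⟨h, h2, has, ?_, hbs, hsb⟩
  have := T.trinormal b s (a * s) has (by grind) (by grind) hbs hsb
  grind

theorem DomVia.of_right {a s b : S} (h : b * s * a = a) (hsa : s * a ∈ T.N) (hbs : b * s ∈ T.Z)
    (hsb : s * b ∈ T.Z) : T.DomVia s a b := by
  have hc := T.Z_comm _ hsb _ hsa
  have h2 : a * s * b = a := by grind
  refine ⟨h2, h, ?_, hsa, hbs, hsb⟩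
  have := T.trinormal s b (s * a) hsa (by grind) (by grind) hsb hbs
  grind

theorem DomVia.trans {a b c b' c' : S} (h : T.DomVia b' a b) (k : T.DomVia c' b c) :
    T.DomVia c' a c := by
  obtain ⟨h1, h2, h3, h4, h5, h6⟩ := h
  obtain ⟨k1, k2, k3, k4, k5, k6⟩ := k
  have := T.N.mul_mem h3 k3
  exact .of_left (by grind) (by grind) k5 k6

theorem DomVia.switch {a b c c' : S} (h : a * b ∈ T.N) (k : T.DomVia c' b c) :
    T.DomVia c (a * b * c') c' := by
  obtain ⟨k1, k2, k3, k4, k5, k6⟩ := k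
  have := T.N.mul_mem h (T.Z_le k6)
  exact .of_left (by grind) (by grind) k6 k5

theorem DomVia.switch' {a b c c' : S} (h : b * a ∈ T.N) (k : T.DomVia c' b c) :
    T.DomVia c (c' * b * a) c' := by
  obtain ⟨k1, k2, k3, k4, k5, k6⟩ := k
  have := T.N.mul_mem (T.Z_le k5) h
  exact .of_right (by grind) (by grind) k6 k5

theorem DomVia.mul {a b b' c d d' : S} (h : T.DomVia b' a b) (k : T.DomVia d' c d) :
    T.DomVia (d' * b') (a * c) (b * d) := by
  obtain ⟨h1, h2, h3, h4, h5, h6⟩ := h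
  obtain ⟨k1, k2, k3, k4, k5, k6⟩ := k
  have e1 := T.Z_comm _ h6 _ k3
  have e2 : b' * a * (c * d') ∈ T.N := T.N.mul_mem h4 k3
  have e3 := T.Z_comm _ h6 _ e2
  have := T.trinormal b' b (b' * a * (c * d')) e2 (by grind) (by grind) h6 h5
  have f1 := (T.binormal _ _ h5 h6 _ k5).1
  have f2 := (T.binormal _ _ k6 k5 _ h6).1
  exact .of_left (by grind) (by grind) (by grind) (by grind)

theorem DomVia.N_mul {a b b' n : S} (hn : n ∈ T.N) (h : T.DomVia b' a b) :
    T.DomVia b' (n * a) b := by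
  obtain ⟨h1, h2, h3, h4, h5, h6⟩ := h
  have := T.N.mul_mem hn h3
  exact .of_left (by grind) (by grind) h5 h6

theorem DomVia.mul_N {a b b' n : S} (hn : n ∈ T.N) (h : T.DomVia b' a b) :
    T.DomVia b' (a * n) b := by
  obtain ⟨h1, h2, h3, h4, h5, h6⟩ := h
  have := T.N.mul_mem h4 hn
  exact .of_right (by grind) (by grind) h5 h6

/-- `C` is a coset: `C C* C ⊆ C = C^<`. -/
def IsCoset (T : StructuredSemigroup S) (C : Set S) : Prop := C * T.dual C * C ⊆ C ∧ C = T.up C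

theorem dom_mul {a b c d : S} (h : T.Dom a b) (k : T.Dom c d) : T.Dom (a * c) (b * d) := by
  obtain ⟨_, h⟩ := h; obtain ⟨_, k⟩ := k; exact ⟨_, h.mul k⟩

theorem dom_trans {a b c : S} (h : T.Dom a b) (k : T.Dom b c) : T.Dom a c := by
  obtain ⟨_, h⟩ := h; obtain ⟨_, k⟩ := k; exact ⟨_, h.trans k⟩

theorem up_mono {A B : Set S} (h : A ⊆ B) : T.up A ⊆ T.up B := fun _ ⟨a, ha, k⟩ => ⟨a, h ha, k⟩

theorem dual_mono {A B : Set S} (h : A ⊆ B) : T.dual A ⊆ T.dual B :=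
  fun _ ⟨a, ha, k⟩ => ⟨a, h ha, k⟩

theorem up_up (A : Set S) : T.up (T.up A) ⊆ T.up A := by
  rintro c ⟨b, ⟨a, ha, h⟩, k⟩; exact ⟨a, ha, dom_trans h k⟩

theorem up_mul_up (A B : Set S) : T.up A * T.up B ⊆ T.up (A * B) := by
  rintro _ ⟨x, ⟨a, ha, h⟩, y, ⟨b, hb, k⟩, rfl⟩
  exact ⟨a * b, Set.mul_mem_mul ha hb, dom_mul h k⟩

theorem dual_mul_dual (A B : Set S) : T.dual A * T.dual B ⊆ T.dual (B * A) := by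
  rintro _ ⟨x, ⟨a, ha, a', h⟩, y, ⟨b, hb, b', k⟩, rfl⟩
  exact ⟨b * a, Set.mul_mem_mul hb ha, _, k.mul h⟩

theorem DomVia.Z_inv {a b b' z : S} (hz : z ∈ T.Z) (e : a * z = a) (h : T.DomVia b' a b) :
    T.DomVia (z * b') a b := by
  obtain ⟨h1, h2, h3, h4, h5, h6⟩ := h
  have f1 := (T.binormal _ _ h5 h6 _ hz).1
  have f2 := T.Z.mul_mem hz h6
  refine .of_left ?_ ?_ ?_ ?_
  · rw [← mul_assoc, e, h1]
  · rwa [← mul_assoc, e]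
  · rwa [← mul_assoc]
  · rwa [mul_assoc]

theorem dual_up (A : Set S) : T.dual (T.up A) ⊆ T.up (T.dual A) := by
  rintro c' ⟨b, ⟨a, ha, b', h⟩, c, k⟩
  have e1 : a * (b' * b) = a := by rw [← mul_assoc, h.left]
  exact ⟨b' * b * c', ⟨a, ha, c, (h.trans k).Z_inv h.sb_mem e1⟩, c, k.switch (T.Z_le h.sb_mem)⟩

theorem up_up_subset_dual_dual (A : Set S) : T.up (T.up A) ⊆ T.dual (T.dual A) := by
  rintro c ⟨b, ⟨a, ha, b', h⟩, c', k⟩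
  have e1 : a * (b' * b) = a := by rw [← mul_assoc, h.left]
  exact ⟨b' * b * c', ⟨a, ha, c, (h.trans k).Z_inv h.sb_mem e1⟩, c', k.switch (T.Z_le h.sb_mem)⟩

theorem triple {A : Set S} (hA : A * T.dual A * A ⊆ A) {a s b : S} (ha : a ∈ A)
    (hs : s ∈ T.dual A) (hb : b ∈ A) : a * s * b ∈ A :=
  hA (Set.mul_mem_mul (Set.mul_mem_mul ha hs) hb)

theorem dual_triple {A : Set S} (hA : A * T.dual A * A ⊆ A) :
    T.dual A * T.dual (T.dual A) * T.dual A ⊆ T.dual A := by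
  intro x hx
  have h1 := dual_mul_dual (T := T) A (T.dual A)
  have h2 := dual_mul_dual (T := T) (T.dual A * A) A
  have := h2 (Set.mul_subset_mul_right h1 hx)
  rw [← mul_assoc] at this
  exact dual_mono hA this

theorem mem_aux {A : Set S} (hA : A * T.dual A * A ⊆ A) {b b' c a : S} (hc : c ∈ A)
    (h : T.DomVia b' c b) (ha : a ∈ T.dual (T.dual A)) : c * b' * (a * b' * c) ∈ A := by
  have hb : b' ∈ T.dual A := ⟨c, hc, b, h⟩
  have := triple hA hc (triple (dual_triple hA) hb ha hb) hc
  simpa only [mul_assoc] using this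

theorem up_dual {A : Set S} (hA : A * T.dual A * A ⊆ A) : T.up (T.dual A) ⊆ T.dual A := by
  rintro a' ⟨b', ⟨c, hc, b, h⟩, a, k⟩
  have ha : a ∈ T.dual (T.dual A) := ⟨b', ⟨c, hc, b, h⟩, a', k⟩
  exact ⟨_, mem_aux hA hc h ha, a, (k.switch' h.sa_mem).N_mul h.as_mem⟩

theorem dual_dual {A : Set S} (hA : A * T.dual A * A ⊆ A) :
    T.dual (T.dual A) ⊆ T.up (T.up A) := by
  rintro a ⟨b', ⟨c, hc, b, h⟩, a', k⟩
  have ha : a ∈ T.dual (T.dual A) := ⟨b', ⟨c, hc, b, h⟩, a', k⟩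
  refine ⟨a * b' * b, ⟨_, mem_aux hA hc h ha, b' * b * a', ?_⟩, a',
    k.switch' (T.Z_le h.sb_mem)⟩
  have hn := h.as_mem
  refine DomVia.N_mul hn ?_
  obtain ⟨h1, h2, h3, h4, h5, h6⟩ := h
  obtain ⟨k1, k2, k3, k4, k5, k6⟩ := k
  have f1 := T.Z.mul_mem h6 h6
  have f2 := (T.binormal _ _ k6 k5 _ f1).1
  have g1 : b' * b * a' * (a * b' * c) = b' * c := by
    calc _ = b' * b * (a' * a * b') * c := by simp only [mul_assoc]
      _ = b' * (b * b' * c) := by rw [k2]; simp only [mul_assoc]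
      _ = _ := by rw [h2]
  have g2 : b' * b * a' * (a * b' * b) = b' * b * (b' * b) := by
    calc _ = b' * b * (a' * a * b') * b := by simp only [mul_assoc]
      _ = _ := by rw [k2]; simp only [mul_assoc]
  refine .of_right ?_ ?_ ?_ ?_
  · calc a * b' * b * (b' * b * a') * (a * b' * c)
        = a * b' * b * (b' * b * a' * (a * b' * c)) := by simp only [mul_assoc]
      _ = a * b' * (b * b' * c) := by rw [g1]; simp only [mul_assoc]
      _ = _ := by rw [h2]
  · rwa [g1]
  · simpa only [mul_assoc] using f2
  · rwa [g2]

/-- `A` is an atlas: `A A* A ⊆ A ⊆ A^<`. -/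
def IsAtlas (T : StructuredSemigroup S) (A : Set S) : Prop := A * T.dual A * A ⊆ A ∧ A ⊆ T.up A

theorem IsAtlas.isCoset_up {A : Set S} (h : T.IsAtlas A) : T.IsCoset (T.up A) := by
  refine ⟨?_, (up_mono h.2).antisymm (up_up A)⟩
  have h1 := Set.mul_subset_mul (Set.mul_subset_mul (subset_refl (T.up A)) (dual_up (T := T) A))
    (subset_refl (T.up A))
  have h2 := Set.mul_subset_mul (up_mul_up (T := T) A (T.dual A)) (subset_refl (T.up A))
  exact h1.trans (h2.trans ((up_mul_up _ _).trans (up_mono h.1)))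

theorem IsCoset.isAtlas {A : Set S} (h : T.IsCoset A) : T.IsAtlas A := ⟨h.1, h.2.subset⟩

theorem IsCoset.up_dual {A : Set S} (h : T.IsCoset A) : T.up (T.dual A) = T.dual A := by
  refine (StructuredSemigroup.up_dual h.1).antisymm ?_
  conv_lhs => rw [h.2]
  exact dual_up A

theorem IsCoset.dual {A : Set S} (h : T.IsCoset A) : T.IsCoset (T.dual A) :=
  ⟨dual_triple h.1, h.up_dual.symm⟩

theorem IsCoset.dual_dual {A : Set S} (h : T.IsCoset A) : T.dual (T.dual A) = A := by
  apply subset_antisymm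
  · conv_rhs => rw [h.2, h.2]
    exact StructuredSemigroup.dual_dual h.1
  · conv_lhs => rw [h.2, h.2]
    exact up_up_subset_dual_dual A

theorem IsAtlas.dual_up {A : Set S} (h : T.IsAtlas A) : T.dual (T.up A) = T.dual A :=
  ((StructuredSemigroup.dual_up A).trans (StructuredSemigroup.up_dual h.1)).antisymm
    (dual_mono h.2)

theorem IsCoset.exists_dom {A : Set S} (h : T.IsCoset A) {c : S} (hc : c ∈ A) :
    ∃ d ∈ A, ∃ c' ∈ T.dual A, T.DomVia c' d c := by
  rw [h.2] at hc
  obtain ⟨d, hd, c', k⟩ := hc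
  exact ⟨d, hd, c', ⟨d, hd, c, k⟩, k⟩

theorem subset_up_mul {A B : Set S} (hA : A ⊆ T.up A) (hB : B ⊆ T.up B) : A * B ⊆ T.up (A * B) :=
  (Set.mul_subset_mul hA hB).trans (up_mul_up A B)

theorem up_up_mul {A B : Set S} (hA : A ⊆ T.up A) (hB : B ⊆ T.up B) :
    T.up (T.up A * B) = T.up (A * B) :=
  ((up_mono ((Set.mul_subset_mul subset_rfl hB).trans (up_mul_up A B))).trans (up_up _)).antisymm
    (up_mono (Set.mul_subset_mul hA subset_rfl))

theorem up_mul_up' {A B : Set S} (hA : A ⊆ T.up A) (hB : B ⊆ T.up B) :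
    T.up (A * T.up B) = T.up (A * B) :=
  ((up_mono ((Set.mul_subset_mul hA subset_rfl).trans (up_mul_up A B))).trans (up_up _)).antisymm
    (up_mono (Set.mul_subset_mul subset_rfl hB))

theorem mul_atlas {A B : Set S} (hA : T.IsCoset A) (hB : T.IsCoset B)
    (h : T.dual A * A ⊆ T.up (B * T.dual B)) :
    T.dual (A * B) * A ⊆ T.dual B ∧ T.IsAtlas (A * B) := by
  have h1 : T.dual A * A * B ⊆ B := by
    refine (Set.mul_subset_mul h hB.2.subset).trans ((up_mul_up _ _).trans ?_)
    conv_rhs => rw [hB.2]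
    exact up_mono hB.1
  have h2 : T.dual (A * B) * A ⊆ T.dual B := by
    have := dual_mul_dual (T := T) (A * B) (T.dual A)
    rw [hA.dual_dual, ← mul_assoc] at this
    exact this.trans (dual_mono h1)
  refine ⟨h2, ?_, subset_up_mul hA.2.subset hB.2.subset⟩
  rw [show A * B * T.dual (A * B) * (A * B) = A * (B * (T.dual (A * B) * A) * B) by
    simp only [mul_assoc]]
  exact Set.mul_subset_mul subset_rfl
    ((Set.mul_subset_mul (Set.mul_subset_mul subset_rfl h2) subset_rfl).trans hB.1)

theorem src_mul_aux {A B : Set S} (hA : T.IsCoset A) (hA0 : A.Nonempty) (hB : T.IsCoset B)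
    (h : T.dual A * A ⊆ T.up (B * T.dual B)) :
    T.up (T.dual (T.up (A * B)) * T.up (A * B)) = T.up (T.dual B * B) := by
  obtain ⟨h1, h2⟩ := mul_atlas hA hB h
  have hd : T.dual (A * B) ⊆ T.up (T.dual (A * B)) := by
    have := h2.isCoset_up.dual.2.subset
    rwa [h2.dual_up] at this
  rw [h2.dual_up, up_mul_up' hd h2.2]
  apply subset_antisymm
  · rw [← mul_assoc]
    exact up_mono (Set.mul_subset_mul h1 subset_rfl)
  · rintro x ⟨_, ⟨c', hc', c, hc, rfl⟩, hx⟩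
    obtain ⟨d', hd', p, -, hp⟩ := hB.dual.exists_dom hc'
    obtain ⟨d, hd, q, -, hq⟩ := hB.exists_dom hc
    obtain ⟨a, ha⟩ := hA0
    obtain ⟨a0, ha0, a', ha', k⟩ := hA.exists_dom ha
    refine ⟨d' * a' * (a * d), Set.mul_mem_mul (dual_mul_dual _ _ (Set.mul_mem_mul hd' ha'))
      (Set.mul_mem_mul ha hd), dom_trans ?_ hx⟩
    have := dom_mul ⟨_, hp⟩ ⟨_, hq.N_mul (T.Z_le k.sb_mem)⟩
    simpa only [mul_assoc] using this

theorem rng_mul_aux {A B : Set S} (hA : T.IsCoset A) (hB : T.IsCoset B) (hB0 : B.Nonempty)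
    (h : T.up (T.dual A * A) = T.up (B * T.dual B)) :
    T.up (T.up (A * B) * T.dual (T.up (A * B))) = T.up (A * T.dual A) := by
  have hAB : T.dual A * A ⊆ T.up (B * T.dual B) := by
    rw [← h]; exact subset_up_mul hA.dual.2.subset hA.2.subset
  have hBA : B * T.dual B ⊆ T.up (T.dual A * A) := by
    rw [h]; exact subset_up_mul hB.2.subset hB.dual.2.subset
  obtain ⟨-, h2⟩ := mul_atlas hA hB hAB
  have hd : T.dual (A * B) ⊆ T.up (T.dual (A * B)) := by
    have := h2.isCoset_up.dual.2.subset
    rwa [h2.dual_up] at this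
  have h1 : B * T.dual (A * B) ⊆ T.dual A := by
    have h3 := dual_mul_dual (T := T) (T.dual B) (A * B)
    rw [hB.dual_dual, mul_assoc] at h3
    refine h3.trans (dual_mono ?_)
    refine (Set.mul_subset_mul hA.2.subset hBA).trans ((up_mul_up _ _).trans ?_)
    conv_rhs => rw [hA.2]
    rw [← mul_assoc]
    exact up_mono hA.1
  rw [h2.dual_up, up_up_mul h2.2 hd]
  apply subset_antisymm
  · rw [mul_assoc]
    exact up_mono (Set.mul_subset_mul subset_rfl h1)
  · rintro x ⟨_, ⟨c, hc, c', hc', rfl⟩, hx⟩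
    obtain ⟨d', hd', p, -, hp⟩ := hA.dual.exists_dom hc'
    obtain ⟨d, hd, q, -, hq⟩ := hA.exists_dom hc
    obtain ⟨b, hb⟩ := hB0
    obtain ⟨b0, hb0, b', hb', k⟩ := hB.exists_dom hb
    refine ⟨d * b * (b' * d'), Set.mul_mem_mul (Set.mul_mem_mul hd hb)
      (dual_mul_dual _ _ (Set.mul_mem_mul hb' hd')), dom_trans ?_ hx⟩
    have := dom_mul ⟨_, hq⟩ ⟨_, hp.N_mul (T.Z_le k.bs_mem)⟩
    simpa only [mul_assoc] using this

theorem self_mul_src {A : Set S} (hA : T.IsCoset A) : T.up (A * T.up (T.dual A * A)) = A := by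
  rw [up_mul_up' hA.2.subset (subset_up_mul hA.dual.2.subset hA.2.subset), ← mul_assoc]
  conv_rhs => rw [hA.2]
  refine (up_mono hA.1).antisymm ((up_mono fun c hc => ?_).trans (up_up _))
  obtain ⟨d, hd, c', hc', k⟩ := hA.exists_dom hc
  refine ⟨d, ?_, c', k⟩
  rw [← k.left]
  exact Set.mul_mem_mul (Set.mul_mem_mul hd hc') hc

theorem rng_mul_self {A : Set S} (hA : T.IsCoset A) : T.up (T.up (A * T.dual A) * A) = A := by
  rw [up_up_mul (subset_up_mul hA.2.subset hA.dual.2.subset) hA.2.subset]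
  conv_rhs => rw [hA.2]
  refine (up_mono hA.1).antisymm ((up_mono fun c hc => ?_).trans (up_up _))
  obtain ⟨d, hd, c', hc', k⟩ := hA.exists_dom hc
  refine ⟨d, ?_, c', k⟩
  rw [← k.right]
  exact Set.mul_mem_mul (Set.mul_mem_mul hc hc') hd

/-- The set of non-empty cosets. -/
@[ext] structure Coset (T : StructuredSemigroup S) where
  carrier : Set S
  isCoset : T.IsCoset carrier
  nonempty : carrier.Nonempty

namespace Coset

/-- The inverse of a coset `C` is its dual `C*`. -/
def inv (C : T.Coset) : T.Coset where
  carrier := T.dual C.carrier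
  isCoset := C.isCoset.dual
  nonempty := by
    obtain ⟨c, hc⟩ := C.nonempty
    obtain ⟨-, -, c', hc', -⟩ := C.isCoset.exists_dom hc
    exact ⟨c', hc'⟩

theorem inv_inv (C : T.Coset) : C.inv.inv = C := Coset.ext C.isCoset.dual_dual

/-- The coset `(B C)^<`, for cosets with `(B* B)^< = (C C*)^<`. -/
def mulOf (B C : T.Coset)
    (h : T.up (T.dual B.carrier * B.carrier) = T.up (C.carrier * T.dual C.carrier)) : T.Coset where
  carrier := T.up (B.carrier * C.carrier)
  isCoset := (mul_atlas B.isCoset C.isCoset (by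
    rw [← h]; exact subset_up_mul B.inv.isCoset.2.subset B.isCoset.2.subset)).2.isCoset_up
  nonempty := (B.nonempty.mul C.nonempty).mono
    (subset_up_mul B.isCoset.2.subset C.isCoset.2.subset)

/-- The source `(C* C)^<` of a coset. -/
def src (C : T.Coset) : T.Coset := mulOf C.inv C (by rw [inv, C.isCoset.dual_dual])
/-- The range `(C C*)^<` of a coset. -/
def rng (C : T.Coset) : T.Coset := mulOf C C.inv (by rw [inv, C.isCoset.dual_dual])

theorem src_inv (C : T.Coset) : C.inv.src = C.rng := by
  ext1; simp only [src, rng, mulOf, inv, C.isCoset.dual_dual]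

theorem rng_inv (C : T.Coset) : C.inv.rng = C.src := by
  ext1; simp only [src, rng, mulOf, inv, C.isCoset.dual_dual]

/-- The product `B · C = (B C)^<`, defined when the source of `B` is the range of `C`. -/
def mul (B C : T.Coset) (h : B.src = C.rng) : T.Coset := mulOf B C (congrArg carrier h)

theorem src_mul (B C : T.Coset) (h : B.src = C.rng) : (B.mul C h).src = C.src :=
  Coset.ext (src_mul_aux B.isCoset B.nonempty C.isCoset (by
    have e : T.up (T.dual B.carrier * B.carrier) = T.up (C.carrier * T.dual C.carrier) :=
      congrArg carrier h
    rw [← e]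
    exact subset_up_mul B.inv.isCoset.2.subset B.isCoset.2.subset))

theorem rng_mul (B C : T.Coset) (h : B.src = C.rng) : (B.mul C h).rng = B.rng :=
  Coset.ext (rng_mul_aux B.isCoset C.isCoset C.nonempty (congrArg carrier h))

/-- The coset groupoid. -/
instance : ArrowGroupoid T.Coset where
  src := src
  rng := rng
  inv := inv
  mul := mul
  rng_src C := (rng_mul C.inv C C.src_inv).trans C.rng_inv
  src_rng C := (src_mul C C.inv C.rng_inv.symm).trans C.src_inv
  src_mul := src_mul
  rng_mul := rng_mul
  mul_src C := Coset.ext (self_mul_src C.isCoset)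
  rng_mul_self C := Coset.ext (rng_mul_self C.isCoset)
  mul_assoc A B C _ _ := Coset.ext <| by
    have hA := A.isCoset.2.subset
    have hB := B.isCoset.2.subset
    have hC := C.isCoset.2.subset
    change T.up (T.up (A.carrier * B.carrier) * C.carrier) =
      T.up (A.carrier * T.up (B.carrier * C.carrier))
    rw [up_up_mul (subset_up_mul hA hB) hC, up_mul_up' hA (subset_up_mul hB hC), mul_assoc]
  src_inv := src_inv
  rng_inv := rng_inv
  inv_mul _ := rfl
  mul_inv _ := rfl

end Coset


/-- The relation `a ∼_A b`: there are `s, t ∈ A*` with `s a t = s b t`. -/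
def Rel (T : StructuredSemigroup S) (A : Set S) (a b : S) : Prop := ∃ s ∈ T.dual A, ∃ t ∈ T.dual A, s * a * t = s * b * t

theorem Rel.symm {A : Set S} {a b : S} (h : T.Rel A a b) : T.Rel A b a := by
  obtain ⟨s, hs, t, ht, h⟩ := h; exact ⟨s, hs, t, ht, h.symm⟩

theorem Rel.exists_right {A : Set S} (hA : T.IsCoset A) {a b : S} (ha : a ∈ A) (hb : b ∈ A)
    (h : T.Rel A a b) : ∃ t ∈ T.dual A, a * t = b * t := by
  obtain ⟨s, hs, t, ht, h⟩ := h
  obtain ⟨s1, hs1, s', hs', ks⟩ := hA.dual.exists_dom hs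
  obtain ⟨t1, ht1, t', ht', kt⟩ := hA.dual.exists_dom ht
  rw [hA.dual_dual] at hs' ht'
  obtain ⟨a1, ha1, a', ha', ka⟩ := hA.exists_dom ha
  obtain ⟨b1, hb1, b', hb', kb⟩ := hA.exists_dom hb
  have tr : ∀ {x y z}, x ∈ A → y ∈ T.dual A → z ∈ A → x * y * z ∈ A := triple hA.1
  have tr' : ∀ {x y z}, x ∈ T.dual A → y ∈ A → z ∈ T.dual A → x * y * z ∈ T.dual A := by
    have := @triple _ _ T _ hA.dual.1
    rwa [hA.dual_dual] at this
  -- right fixers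
  let P : S → Prop := fun z => z ∈ T.Z ∧ ∃ n ∈ T.N, n * z = n ∧ ∀ u ∈ T.dual A, n * u ∈ T.dual A
  have Pmul : ∀ y z, P y → P z → P (y * z) := by
    rintro y z ⟨hy, n, hn, e1, f1⟩ ⟨hz, m, hm, e2, f2⟩
    refine ⟨T.Z.mul_mem hy hz, n * m, T.N.mul_mem hn hm, ?_, fun u hu => ?_⟩
    · have := T.Z_comm y hy m hm
      calc n * m * (y * z) = n * (m * y) * z := by simp only [mul_assoc]
        _ = (n * y) * (m * z) := by rw [← this]; simp only [mul_assoc]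
        _ = _ := by rw [e1, e2]
    · rw [mul_assoc]; exact f1 _ (f2 _ hu)
  have Pa : P (a' * a) := ⟨ka.sb_mem, a' * a1, ka.sa_mem, by
    rw [mul_assoc, ← mul_assoc a1, ka.left], fun u hu => tr' ha' ha1 hu⟩
  have Pb : P (b' * b) := ⟨kb.sb_mem, b' * b1, kb.sa_mem, by
    rw [mul_assoc, ← mul_assoc b1, kb.left], fun u hu => tr' hb' hb1 hu⟩
  have Py : P (t * t') := ⟨kt.bs_mem, t1 * t', kt.as_mem, by
    rw [← mul_assoc (t1 * t'), kt.left], fun u hu => tr' ht1 ht' hu⟩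
  have Pw : ∀ c c' c1, c' ∈ T.dual A → c1 ∈ A → T.DomVia c' c1 c → P (c' * (s' * s) * c) := by
    rintro c c' c1 hc' hc1 k
    have hm := ks.sa_mem
    have e1 : s' * s1 * (s' * s) = s' * s1 := by rw [mul_assoc, ← mul_assoc s1, ks.left]
    have n1 : s' * s1 * (c1 * c') ∈ T.N := T.N.mul_mem hm k.as_mem
    have n2 : c' * (s' * s1 * (c1 * c')) * c ∈ T.N := by
      have c1m := T.Z_comm _ k.bs_mem _ n1
      have : c * c' * (s' * s1 * (c1 * c')) = s' * s1 * (c1 * c') := by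
        have := T.Z_comm _ k.bs_mem _ hm
        calc c * c' * (s' * s1 * (c1 * c')) = c * c' * (s' * s1) * c1 * c' := by
              simp only [mul_assoc]
          _ = s' * s1 * (c * c' * c1) * c' := by rw [this]; simp only [mul_assoc]
          _ = _ := by rw [k.right]; simp only [mul_assoc]
      exact T.trinormal c c' _ n1 this (by rw [mul_assoc, ← c1m, this]) k.bs_mem k.sb_mem
    have e2 : c' * (s' * s1 * (c1 * c')) * c = c' * (s' * s1) * c1 := by
      calc _ = c' * (s' * s1) * (c1 * c' * c) := by simp only [mul_assoc]
        _ = _ := by rw [k.left]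
    rw [e2] at n2
    refine ⟨(T.binormal _ _ k.sb_mem k.bs_mem _ ks.sb_mem).1, _, n2, ?_, fun u hu => ?_⟩
    · have := T.Z_comm _ ks.sb_mem _ k.as_mem
      calc c' * (s' * s1) * c1 * (c' * (s' * s) * c)
          = c' * (s' * s1) * (c1 * c' * (s' * s)) * c := by simp only [mul_assoc]
        _ = c' * (s' * s1 * (s' * s)) * (c1 * c' * c) := by rw [← this]; simp only [mul_assoc]
        _ = _ := by rw [e1, k.left]
    · have := tr' (tr' hc' hs' hs1) hc1 hu
      simpa only [mul_assoc] using this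
  have E1 : s' * s * a * (t * t') = s' * s * b * (t * t') := by
    calc _ = s' * (s * a * t) * t' := by simp only [mul_assoc]
      _ = _ := by rw [h]; simp only [mul_assoc]
  have F : ∀ c c' c1, T.DomVia c' c1 c →
      s' * s * c * (t * t') * (c' * c) = c * (c' * (s' * s) * c * (t * t')) := by
    intro c c' c1 k
    have h1 := T.Z_comm _ kt.bs_mem _ (T.Z_le k.sb_mem)
    have h2 := T.Z_comm _ ks.sb_mem _ (T.Z_le k.bs_mem)
    calc s' * s * c * (t * t') * (c' * c) = s' * s * c * (t * t' * (c' * c)) := by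
          simp only [mul_assoc]
      _ = s' * s * (c * c') * c * (t * t') := by rw [h1]; simp only [mul_assoc]
      _ = _ := by rw [h2]; simp only [mul_assoc]
  have E2 : a * (a' * (s' * s) * a * (t * t') * (b' * b)) = b * (b' * (s' * s) * b * (t * t') * (a' * a)) := by
    have h1 := T.Z_comm _ ka.sb_mem _ (T.Z_le kb.sb_mem)
    rw [← mul_assoc a, ← F _ _ _ ka, ← mul_assoc b, ← F _ _ _ kb, E1, mul_assoc _ (a' * a), h1,
      mul_assoc _ (b' * b)]
  obtain ⟨hp, n, hn, en, fn⟩ := Pmul _ _ (Pmul _ _ (Pw a a' a1 ha' ha1 ka) Py) Pb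
  obtain ⟨hq, m, hm, em, fm⟩ := Pmul _ _ (Pmul _ _ (Pw b b' b1 hb' hb1 kb) Py) Pa
  rw [← T.Z_comm _ hp _ hn] at en
  rw [← T.Z_comm _ hq _ hm] at em
  refine ⟨n * (m * t), fn _ (fm _ ht), ?_⟩
  calc a * (n * (m * t)) = a * (a' * (s' * s) * a * (t * t') * (b' * b)) * (n * (m * t)) := by
        conv_lhs => rw [← en]
        simp only [mul_assoc]
    _ = b * (b' * (s' * s) * b * (t * t') * (a' * a) * n) * (m * t) := by
        rw [E2]; simp only [mul_assoc]
    _ = b * n * (b' * (s' * s) * b * (t * t') * (a' * a) * m) * t := by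
        rw [T.Z_comm _ hq _ hn]; simp only [mul_assoc]
    _ = _ := by rw [em]; simp only [mul_assoc]

theorem Rel.trans {A : Set S} (hA : T.IsCoset A) {a b c : S} (ha : a ∈ A) (hb : b ∈ A) (hc : c ∈ A)
    (h : T.Rel A a b) (k : T.Rel A b c) : T.Rel A a c := by
  obtain ⟨t, ht, e⟩ := h.exists_right hA ha hb
  obtain ⟨u, hu, f⟩ := k.exists_right hA hb hc
  obtain ⟨t1, ht1, t', ht', kt⟩ := hA.dual.exists_dom ht
  obtain ⟨u1, hu1, u', hu', ku⟩ := hA.dual.exists_dom hu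
  refine ⟨t, ht, t * t' * u1, triple hA.dual.1 ht ht' hu1, ?_⟩
  have h1 : t * t' * u1 = u * (u' * (t * t') * u1) := by
    have := T.Z_comm _ kt.bs_mem _ (T.Z_le ku.bs_mem)
    calc t * t' * u1 = t * t' * (u * u' * u1) := by rw [ku.right]
      _ = t * t' * (u * u') * u1 := by simp only [mul_assoc]
      _ = _ := by rw [this]; simp only [mul_assoc]
  have h2 : a * (t * t' * u1) = c * (t * t' * u1) := by
    calc a * (t * t' * u1) = a * t * (t' * u1) := by simp only [mul_assoc]
      _ = b * (t * t' * u1) := by rw [e]; simp only [mul_assoc]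
      _ = b * u * (u' * (t * t') * u1) := by rw [h1]; simp only [mul_assoc]
      _ = _ := by rw [f, h1]; simp only [mul_assoc]
  rw [mul_assoc t a, mul_assoc t c, h2]

theorem Rel.refl {A : Set S} (hA : T.IsCoset A) {a : S} (ha : a ∈ A) (b : S) : T.Rel A b b := by
  obtain ⟨-, -, s, hs, -⟩ := hA.exists_dom ha
  exact ⟨s, hs, s, hs, rfl⟩

theorem Rel.mul {A B C : T.Coset} (h : A.src = B.rng) (e : C = A.mul B h) {a b c d : S}
    (ha : a ∈ A.carrier) (hc : c ∈ A.carrier) (hb : b ∈ B.carrier) (hd : d ∈ B.carrier)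
    (hac : T.Rel A.carrier a c) (hbd : T.Rel B.carrier b d) : T.Rel C.carrier (a * b) (c * d) := by
  subst e
  obtain ⟨t, ht, e⟩ := hac.exists_right A.isCoset ha hc
  obtain ⟨u, hu, f⟩ := hbd.exists_right B.isCoset hb hd
  have hU : d * u ∈ B.rng.carrier :=
    subset_up_mul B.isCoset.2.subset B.inv.isCoset.2.subset (Set.mul_mem_mul hd hu)
  obtain ⟨_, -, k, hk, kk⟩ := B.rng.isCoset.exists_dom hU
  have hk' : k ∈ B.rng.carrier := by
    have : B.rng.inv = B.rng :=
      ArrowGroupoid.inv_eq_of_src (ArrowGroupoid.src_rng B)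
    rw [← this]; exact hk
  have huk : u * k ∈ T.dual B.carrier := by
    have h1 : T.up (T.dual B.carrier * B.inv.src.carrier) = T.dual B.carrier :=
      self_mul_src B.inv.isCoset
    rw [← h1]
    refine subset_up_mul B.inv.isCoset.2.subset B.inv.src.isCoset.2.subset
      (Set.mul_mem_mul hu ?_)
    rwa [Coset.src_inv]
  obtain ⟨t1, ht1, t', ht', kt⟩ := A.inv.isCoset.exists_dom ht
  have hv : u * k * t1 ∈ T.dual (T.up (A.carrier * B.carrier)) :=
    dual_mono (subset_up_mul A.isCoset.2.subset B.isCoset.2.subset)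
      (dual_mul_dual _ _ (Set.mul_mem_mul huk ht1))
  have hm := T.Z_comm _ kt.bs_mem _ (T.Z_le kk.bs_mem)
  have h1 : d * (u * k * t1) = t * (t' * (d * u * k) * t1) := by
    calc d * (u * k * t1) = d * u * k * (t * t' * t1) := by
          rw [kt.right]; simp only [mul_assoc]
      _ = d * u * k * (t * t') * t1 := by simp only [mul_assoc]
      _ = _ := by rw [← hm]; simp only [mul_assoc]
  have h2 : a * b * (u * k * t1) = c * d * (u * k * t1) := by
    calc a * b * (u * k * t1) = a * (b * u * k * t1) := by simp only [mul_assoc]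
      _ = a * (d * (u * k * t1)) := by rw [f]; simp only [mul_assoc]
      _ = a * t * (t' * (d * u * k) * t1) := by rw [h1]; simp only [mul_assoc]
      _ = c * (d * (u * k * t1)) := by rw [e, h1]; simp only [mul_assoc]
      _ = _ := by simp only [mul_assoc]
  refine ⟨_, hv, _, hv, ?_⟩
  rw [mul_assoc _ (a * b), h2, ← mul_assoc]

theorem Rel.inv {A : Set S} (hA : T.IsCoset A) {c c' d e e' f : S} (hd : d ∈ A) (hf : f ∈ A)
    (hc : T.DomVia c' d c) (he : T.DomVia e' f e) (hcA : c ∈ A) (heA : e ∈ A) (h : T.Rel A c e) :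
    T.Rel (T.dual A) c' e' := by
  obtain ⟨u, hu, k⟩ := h.exists_right hA hcA heA
  have he' : e' ∈ T.dual A := ⟨f, hf, e, he⟩
  rw [Rel, hA.dual_dual]
  refine ⟨d * e' * f, triple hA.1 hd he' hf, c * u * c, triple hA.1 hcA hu hcA, ?_⟩
  have h1 : d * e' * f * (c' * c) = d * e' * f := by
    have := T.Z_comm _ hc.sb_mem _ he.sa_mem
    calc d * e' * f * (c' * c) = d * (e' * f * (c' * c)) := by simp only [mul_assoc]
      _ = d * c' * c * (e' * f) := by rw [← this]; simp only [mul_assoc]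
      _ = _ := by rw [hc.left]; simp only [mul_assoc]
  have h2 : d * e' * f * (e' * e) = d * e' * f := by
    calc d * e' * f * (e' * e) = d * e' * (f * e' * e) := by simp only [mul_assoc]
      _ = _ := by rw [he.left]
  calc d * e' * f * c' * (c * u * c) = d * e' * f * (c' * c) * (u * c) := by simp only [mul_assoc]
    _ = d * e' * f * (e' * e) * (u * c) := by rw [h1, h2]
    _ = d * e' * f * e' * (e * u * c) := by simp only [mul_assoc]
    _ = _ := by rw [← k]

/-- The equivalence class of `a` in the coset `A` modulo `∼_A`. -/
def cls (T : StructuredSemigroup S) (A : Set S) (a : S) : Set S := {x ∈ A | T.Rel A x a}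

theorem cls_eq {A : Set S} (hA : T.IsCoset A) {a b : S} (ha : a ∈ A) (hb : b ∈ T.cls A a) :
    T.cls A b = T.cls A a := by
  ext x
  exact ⟨fun hx => ⟨hx.1, hx.2.trans hA hx.1 hb.1 ha hb.2⟩,
    fun hx => ⟨hx.1, hx.2.trans hA hx.1 ha hb.1 hb.2.symm⟩⟩

/-- The total space of the coset bundle: pairs consisting of a `∼_C`-equivalence class of an
element of a non-empty coset `C`, together with `C` itself. -/
@[ext] structure Germ (T : StructuredSemigroup S) where
  cls : Set S
  base : T.Coset
  isClass : ∃ a ∈ base.carrier, cls = T.cls base.carrier a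

namespace Germ

/-- The element `[a, C]`, for `a ∈ C`. -/
def germ (C : T.Coset) (a : S) (ha : a ∈ C.carrier) : T.Germ := ⟨T.cls C.carrier a, C, a, ha, rfl⟩

theorem nonempty (p : T.Germ) : ∃ a, a ∈ p.cls := by
  obtain ⟨a, ha, e⟩ := p.isClass
  exact ⟨a, e ▸ ⟨ha, Rel.refl p.base.isCoset ha a⟩⟩

theorem mem_base {p : T.Germ} {a : S} (ha : a ∈ p.cls) : a ∈ p.base.carrier := by
  obtain ⟨b, hb, e⟩ := p.isClass
  exact (e ▸ ha : a ∈ T.cls p.base.carrier b).1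

theorem cls_eq {p : T.Germ} {a : S} (ha : a ∈ p.cls) : p.cls = T.cls p.base.carrier a := by
  obtain ⟨b, hb, e⟩ := p.isClass
  rw [e] at ha ⊢
  exact (StructuredSemigroup.cls_eq p.base.isCoset hb ha).symm

theorem mem_of_rel {p : T.Germ} {a b : S} (ha : a ∈ p.cls) (hb : b ∈ p.base.carrier)
    (h : T.Rel p.base.carrier b a) : b ∈ p.cls := by
  rw [cls_eq ha]; exact ⟨hb, h⟩

theorem rel {p : T.Germ} {a b : S} (ha : a ∈ p.cls) (hb : b ∈ p.cls) :
    T.Rel p.base.carrier b a := by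
  rw [cls_eq ha] at hb; exact hb.2

theorem ext_of_mem {p q : T.Germ} {a : S} (h : p.base = q.base) (hp : a ∈ p.cls) (hq : a ∈ q.cls) :
    p = q := by
  refine Germ.ext ?_ h
  rw [cls_eq hp, cls_eq hq, h]

/-- The product `[a, A] [b, B] = [a b, A · B]`, defined when the source of `A` is the range of `B`. -/
def mul (p q : T.Germ) (h : p.base.src = q.base.rng) : T.Germ where
  base := p.base.mul q.base h
  cls := {x ∈ (p.base.mul q.base h).carrier | ∃ a ∈ p.cls, ∃ b ∈ q.cls,
    T.Rel (p.base.mul q.base h).carrier x (a * b)}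
  isClass := by
    obtain ⟨a, ha⟩ := p.nonempty
    obtain ⟨b, hb⟩ := q.nonempty
    have mem : ∀ {x y}, x ∈ p.cls → y ∈ q.cls → x * y ∈ (p.base.mul q.base h).carrier :=
      fun hx hy => subset_up_mul p.base.isCoset.2.subset q.base.isCoset.2.subset
        (Set.mul_mem_mul (mem_base hx) (mem_base hy))
    refine ⟨a * b, mem ha hb, ?_⟩
    ext x
    refine ⟨?_, fun hx => ⟨hx.1, a, ha, b, hb, hx.2⟩⟩
    rintro ⟨hx, c, hc, d, hd, k⟩
    exact ⟨hx, k.trans (p.base.mul q.base h).isCoset hx (mem hc hd) (mem ha hb)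
      (Rel.mul h rfl (mem_base hc) (mem_base ha) (mem_base hd) (mem_base hb) (rel ha hc) (rel hb hd))⟩

theorem mul_mem {p q : T.Germ} (h : p.base.src = q.base.rng) {a b : S} (ha : a ∈ p.cls)
    (hb : b ∈ q.cls) : a * b ∈ (p.mul q h).cls := by
  have : a * b ∈ (p.base.mul q.base h).carrier :=
    subset_up_mul p.base.isCoset.2.subset q.base.isCoset.2.subset
        (Set.mul_mem_mul (mem_base ha) (mem_base hb))
  exact ⟨this, a, ha, b, hb, Rel.refl (p.base.mul q.base h).isCoset this _⟩

/-- The inverse `[c, C]⁻¹ = [c', C*]`, for any `c'` with `d <_{c'} c` for some `d ∈ C`. -/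
def inv (p : T.Germ) : T.Germ where
  base := p.base.inv
  cls := {x ∈ p.base.inv.carrier | ∃ c ∈ p.cls, ∃ c', ∃ d ∈ p.base.carrier,
    T.DomVia c' d c ∧ T.Rel p.base.inv.carrier x c'}
  isClass := by
    obtain ⟨c, hc⟩ := p.nonempty
    obtain ⟨d, hd, c', hc', k⟩ := p.base.isCoset.exists_dom (mem_base hc)
    refine ⟨c', hc', ?_⟩
    ext x
    refine ⟨?_, fun hx => ⟨hx.1, c, hc, c', d, hd, k, hx.2⟩⟩
    rintro ⟨hx, e, he, e', f, hf, k', r⟩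
    exact ⟨hx, r.trans p.base.inv.isCoset hx ⟨f, hf, e, k'⟩ hc'
      (Rel.inv p.base.isCoset hf hd k' k (mem_base he) (mem_base hc) (rel hc he))⟩

theorem inv_mem {p : T.Germ} {c c' d : S} (hc : c ∈ p.cls) (hd : d ∈ p.base.carrier)
    (k : T.DomVia c' d c) : c' ∈ p.inv.cls := by
  have : c' ∈ p.base.inv.carrier := ⟨d, hd, c, k⟩
  exact ⟨this, c, hc, c', d, hd, k, Rel.refl p.base.inv.isCoset this _⟩

theorem unit_mul {U : T.Coset} (hU : U.src = U) {x y : S} (hx : x ∈ U.carrier)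
    (hy : y ∈ U.carrier) : x * y ∈ U.carrier := by
  have hd : T.dual U.carrier = U.carrier :=
    congrArg Coset.carrier (ArrowGroupoid.inv_eq_of_src hU)
  have h1 : T.up (T.dual U.carrier * U.carrier) = U.carrier := congrArg Coset.carrier hU
  rw [hd] at h1
  rw [← h1]
  exact subset_up_mul U.isCoset.2.subset U.isCoset.2.subset (Set.mul_mem_mul hx hy)

theorem unit_fix {U : T.Coset} (hU : U.src = U) {z u : S} (hu : u ∈ U.carrier)
    (e : u * z = u) : ∃ n ∈ U.carrier, n ∈ T.N ∧ n * z = n := by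
  have hd : T.dual U.carrier = U.carrier :=
    congrArg Coset.carrier (ArrowGroupoid.inv_eq_of_src hU)
  obtain ⟨v, hv, u', hu', k⟩ := U.isCoset.exists_dom hu
  have e1 : v * z = v := by
    have := k.left
    calc v * z = v * u' * u * z := by rw [this]
      _ = v * u' * (u * z) := by simp only [mul_assoc]
      _ = v := by rw [e, k.left]
  exact ⟨u' * v, unit_mul hU (hd ▸ hu') hv, k.sa_mem, by rw [mul_assoc, e1]⟩

theorem unit_mem {U : T.Coset} (hU : U.src = U) {z u : S} (hz : z ∈ T.Z) (hu : u ∈ U.carrier)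
    (e : u * z = u) : z ∈ U.carrier := by
  obtain ⟨n, hn, hN, e⟩ := unit_fix hU hu e
  rw [U.isCoset.2]
  exact ⟨n, hn, z, .of_left (by rw [e, e]) (by rwa [e]) (T.Z.mul_mem hz hz) (T.Z.mul_mem hz hz)⟩

theorem unit_rel {U : T.Coset} (hU : U.src = U) {y z u v : S} (hy : y ∈ T.Z)
    (hu : u ∈ U.carrier) (eu : u * y = u) (hv : v ∈ U.carrier) (ev : v * z = v) :
    T.Rel U.carrier y z := by
  have hd : T.dual U.carrier = U.carrier :=
    congrArg Coset.carrier (ArrowGroupoid.inv_eq_of_src hU)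
  obtain ⟨n, hn, hnN, e⟩ := unit_fix hU hu eu
  obtain ⟨m, hm, hmN, f⟩ := unit_fix hU hv ev
  rw [Rel, hd]
  refine ⟨n * m, unit_mul hU hn hm, n * m, unit_mul hU hn hm, ?_⟩
  rw [mul_assoc n m y, ← T.Z_comm y hy m hmN, ← mul_assoc n y, e, mul_assoc n m z, f]

/-- The unit `[z, U]` over a unit coset `U`, for any `z ∈ Z` with `u z = u` for some `u ∈ U`. -/
def unit (U : T.Coset) (hU : U.src = U) : T.Germ where
  base := U
  cls := {x ∈ U.carrier | ∃ z ∈ T.Z, ∃ u ∈ U.carrier, u * z = u ∧ T.Rel U.carrier x z}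
  isClass := by
    obtain ⟨u, hu⟩ := U.nonempty
    obtain ⟨d, hd, u', hu', k⟩ := U.isCoset.exists_dom hu
    have e : d * (u' * u) = d := by rw [← mul_assoc, k.left]
    have hm := unit_mem hU k.sb_mem hd e
    refine ⟨u' * u, hm, ?_⟩
    ext x
    refine ⟨?_, fun hx => ⟨hx.1, _, k.sb_mem, d, hd, e, hx.2⟩⟩
    rintro ⟨hx, z, hz, v, hv, f, r⟩
    exact ⟨hx, r.trans U.isCoset hx (unit_mem hU hz hv f) hm (unit_rel hU hz hv f hd e)⟩

theorem unit_mem_cls {U : T.Coset} (hU : U.src = U) {z u : S} (hz : z ∈ T.Z) (hu : u ∈ U.carrier)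
    (e : u * z = u) : z ∈ (unit U hU).cls :=
  have h := unit_mem hU hz hu e
  ⟨h, z, hz, u, hu, e, Rel.refl U.isCoset h z⟩

theorem exists_fix (U : T.Coset) : ∃ z ∈ T.Z, ∃ u ∈ U.carrier, u * z = u := by
  obtain ⟨u, hu⟩ := U.nonempty
  obtain ⟨d, hd, u', hu', k⟩ := U.isCoset.exists_dom hu
  exact ⟨u' * u, k.sb_mem, d, hd, by rw [← mul_assoc, k.left]⟩

theorem src_src (C : T.Coset) : C.src.src = C.src :=
  (congrArg Coset.src (ArrowGroupoid.rng_src C).symm).trans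
    ((ArrowGroupoid.src_rng _).trans (ArrowGroupoid.rng_src C))

/-- The source of `[c, C]` is the unit over the source of `C`. -/
def src (p : T.Germ) : T.Germ := unit p.base.src (src_src p.base)

/-- The range of `[c, C]` is the unit over the range of `C`. -/
def rng (p : T.Germ) : T.Germ := unit p.base.rng (ArrowGroupoid.src_rng p.base)

theorem mul_mem' {A B C : T.Coset} (h : A.src = B.rng) (e : A.mul B h = C) {a b : S}
    (ha : a ∈ A.carrier) (hb : b ∈ B.carrier) : a * b ∈ C.carrier := by
  rw [← e]
  exact subset_up_mul A.isCoset.2.subset B.isCoset.2.subset (Set.mul_mem_mul ha hb)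

/-- The groupoid structure on the total space of the coset bundle. -/
instance : ArrowGroupoid T.Germ where
  src := src
  rng := rng
  inv := inv
  mul p q h := mul p q (congrArg base h)
  rng_src p := by
    have h : p.base.src.rng = p.base.src := ArrowGroupoid.rng_src p.base
    obtain ⟨z, hz, u, hu, e⟩ := exists_fix p.base.src
    refine ext_of_mem (a := z) h ?_ (unit_mem_cls _ hz hu e)
    exact unit_mem_cls _ hz (h.symm ▸ hu) e
  src_rng p := by
    have h : p.base.rng.src = p.base.rng := ArrowGroupoid.src_rng p.base
    obtain ⟨z, hz, u, hu, e⟩ := exists_fix p.base.rng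
    refine ext_of_mem (a := z) h ?_ (unit_mem_cls _ hz hu e)
    exact unit_mem_cls _ hz (h.symm ▸ hu) e
  src_mul p q h := by
    have h : (p.base.mul q.base (congrArg base h)).src = q.base.src := ArrowGroupoid.src_mul _ _ _
    obtain ⟨z, hz, u, hu, e⟩ := exists_fix q.base.src
    refine ext_of_mem (a := z) h ?_ (unit_mem_cls _ hz hu e)
    exact unit_mem_cls _ hz (h.symm ▸ hu) e
  rng_mul p q h := by
    have h : (p.base.mul q.base (congrArg base h)).rng = p.base.rng := ArrowGroupoid.rng_mul _ _ _
    obtain ⟨z, hz, u, hu, e⟩ := exists_fix p.base.rng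
    refine ext_of_mem (a := z) h ?_ (unit_mem_cls _ hz hu e)
    exact unit_mem_cls _ hz (h.symm ▸ hu) e
  src_inv p := by
    have h : p.base.inv.src = p.base.rng := ArrowGroupoid.src_inv p.base
    obtain ⟨z, hz, u, hu, e⟩ := exists_fix p.base.rng
    refine ext_of_mem (a := z) h ?_ (unit_mem_cls _ hz hu e)
    exact unit_mem_cls _ hz (h.symm ▸ hu) e
  rng_inv p := by
    have h : p.base.inv.rng = p.base.src := ArrowGroupoid.rng_inv p.base
    obtain ⟨z, hz, u, hu, e⟩ := exists_fix p.base.src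
    refine ext_of_mem (a := z) h ?_ (unit_mem_cls _ hz hu e)
    exact unit_mem_cls _ hz (h.symm ▸ hu) e
  mul_src p := by
    obtain ⟨z, hz, u, hu, e⟩ := exists_fix p.base.src
    obtain ⟨a, ha⟩ := p.nonempty
    have hb : p.base.mul p.base.src (ArrowGroupoid.rng_src p.base).symm = p.base :=
      ArrowGroupoid.mul_src p.base
    have hzU := unit_mem_cls (src_src p.base) hz hu e
    obtain ⟨n, hn, hnN, f⟩ := unit_fix (src_src p.base) hu e
    obtain ⟨c, hc⟩ := p.base.inv.nonempty
    have hnc : n * c ∈ p.base.inv.carrier :=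
      mul_mem' (ArrowGroupoid.src_rng p.base.inv) (ArrowGroupoid.rng_mul_self p.base.inv)
        (show n ∈ p.base.inv.rng.carrier from (Coset.rng_inv p.base).symm ▸ hn) hc
    refine ext_of_mem (a := a * z) hb (mul_mem _ ha hzU)
      (mem_of_rel ha (mul_mem' _ hb (mem_base ha) (mem_base hzU)) ⟨_, hnc, _, hnc, ?_⟩)
    calc n * c * (a * z) * (n * c) = n * c * a * (z * n) * c := by simp only [_root_.mul_assoc]
      _ = _ := by rw [T.Z_comm z hz n hnN, f]; simp only [_root_.mul_assoc]
  rng_mul_self p := by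
    obtain ⟨z, hz, u, hu, e⟩ := exists_fix p.base.rng
    obtain ⟨a, ha⟩ := p.nonempty
    have hU : p.base.rng.src = p.base.rng := ArrowGroupoid.src_rng p.base
    have hb : p.base.rng.mul p.base hU = p.base := ArrowGroupoid.rng_mul_self p.base
    have hzU := unit_mem_cls hU hz hu e
    obtain ⟨n, hn, hnN, f⟩ := unit_fix hU hu e
    obtain ⟨c, hc⟩ := p.base.inv.nonempty
    have hcn : c * n ∈ p.base.inv.carrier :=
      mul_mem' (ArrowGroupoid.rng_src p.base.inv).symm (ArrowGroupoid.mul_src p.base.inv) hc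
        (show n ∈ p.base.inv.src.carrier from (Coset.src_inv p.base).symm ▸ hn)
    refine ext_of_mem (a := z * a) hb (mul_mem _ hzU ha)
      (mem_of_rel ha (mul_mem' _ hb (mem_base hzU) (mem_base ha)) ⟨_, hcn, _, hcn, ?_⟩)
    calc c * n * (z * a) * (c * n) = c * (n * z) * a * (c * n) := by simp only [_root_.mul_assoc]
      _ = _ := by rw [f]
  mul_assoc p q r h₁ h₂ := by
    obtain ⟨a, ha⟩ := p.nonempty
    obtain ⟨b, hb⟩ := q.nonempty
    obtain ⟨c, hc⟩ := r.nonempty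
    refine ext_of_mem (a := a * b * c) (ArrowGroupoid.mul_assoc p.base q.base r.base
      (congrArg base h₁) (congrArg base h₂)) (mul_mem _ (mul_mem _ ha hb) hc) ?_
    rw [_root_.mul_assoc]
    exact mul_mem _ ha (mul_mem _ hb hc)
  inv_mul p := by
    obtain ⟨c, hc⟩ := p.nonempty
    obtain ⟨d, hd, c', hc', k⟩ := p.base.isCoset.exists_dom (mem_base hc)
    refine ext_of_mem (a := c' * c) (ArrowGroupoid.inv_mul p.base)
      (mul_mem _ (inv_mem hc hd k) hc) ?_
    refine unit_mem_cls _ k.sb_mem (u := c' * d) ?_ ?_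
    · exact subset_up_mul p.base.inv.isCoset.2.subset p.base.isCoset.2.subset
        (Set.mul_mem_mul hc' hd)
    · rw [_root_.mul_assoc, ← _root_.mul_assoc d, k.left]
  mul_inv p := by
    obtain ⟨c, hc⟩ := p.nonempty
    obtain ⟨d, hd, c', hc', k⟩ := p.base.isCoset.exists_dom (mem_base hc)
    refine ext_of_mem (a := c * c') (ArrowGroupoid.mul_inv p.base)
      (mul_mem _ hc (inv_mem hc hd k)) ?_
    refine unit_mem_cls _ k.bs_mem (u := d * c') ?_ ?_
    · exact subset_up_mul p.base.isCoset.2.subset p.base.inv.isCoset.2.subset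
        (Set.mul_mem_mul hd hc')
    · rw [← _root_.mul_assoc (d * c'), k.left]

theorem germ_mul_germ {A B : T.Coset} (h : A.src = B.rng) {a b : S} (ha : a ∈ A.carrier)
    (hb : b ∈ B.carrier) :
    (germ A a ha).mul (germ B b hb) h = germ (A.mul B h) (a * b) (mul_mem' h rfl ha hb) :=
  ext_of_mem rfl (mul_mem _ ⟨ha, Rel.refl A.isCoset ha a⟩ ⟨hb, Rel.refl B.isCoset hb b⟩)
    ⟨mul_mem' h rfl ha hb, Rel.refl (A.mul B h).isCoset (mul_mem' h rfl ha hb) _⟩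

theorem inv_germ {C : T.Coset} {c c' d : S} (hc : c ∈ C.carrier) (hd : d ∈ C.carrier)
    (k : T.DomVia c' d c) : (germ C c hc).inv = germ C.inv c' ⟨d, hd, c, k⟩ :=
  ext_of_mem rfl (inv_mem ⟨hc, Rel.refl C.isCoset hc c⟩ hd k)
    ⟨⟨d, hd, c, k⟩, Rel.refl C.inv.isCoset ⟨d, hd, c, k⟩ _⟩

end Germ

/-! Directed cosets. -/

/-- `D` is directed with respect to domination. -/
def Directed (T : StructuredSemigroup S) (D : Set S) : Prop :=
  ∀ a ∈ D, ∀ b ∈ D, ∃ d ∈ D, T.Dom d a ∧ T.Dom d b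

theorem Directed.dual {D : Set S} (h : T.Directed D) : T.Directed (T.dual D) := by
  rintro b' ⟨a, ha, b, k⟩ d' ⟨c, hc, d, l⟩
  obtain ⟨f, hf, hfa, hfc⟩ := h a ha c hc
  obtain ⟨e, he, ⟨f', m⟩, -⟩ := h f hf f hf
  obtain ⟨x, hfa⟩ := hfa
  obtain ⟨y, hfc⟩ := hfc
  have fb := hfa.trans k
  have fd := hfc.trans l
  have eb := m.trans fb
  refine ⟨b' * f * d', ⟨e, he, d * f' * b, ?_⟩, ⟨b, fb.switch' fd.as_mem⟩, ⟨d, fd.switch fb.sa_mem⟩⟩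
  have n1 := T.N.mul_mem eb.as_mem fd.as_mem
  have z1 := (T.binormal _ _ k.bs_mem k.sb_mem _
    (T.binormal _ _ m.bs_mem m.sb_mem _ l.sb_mem).1).2
  have z2 := (T.binormal _ _ l.bs_mem l.sb_mem _
    (T.binormal _ _ m.bs_mem m.sb_mem _ k.bs_mem).2).1
  refine .of_left ?_ ?_ ?_ ?_
  · have c1 := T.Z_comm _ m.bs_mem _ eb.as_mem
    calc e * (b' * f * d') * (d * f' * b) = e * b' * (f * d' * d) * f' * b := by
          simp only [mul_assoc]
      _ = e * b' * (f * f') * b := by rw [fd.left]; simp only [mul_assoc]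
      _ = f * f' * (e * b' * b) := by rw [← c1]; simp only [mul_assoc]
      _ = e := by rw [eb.left, m.right]
  · simpa only [mul_assoc] using n1
  · simpa only [mul_assoc] using z2
  · simpa only [mul_assoc] using z1

theorem Directed.up_mul {D E : Set S} (hD : T.Directed D) (hE : T.Directed E) :
    T.Directed (T.up (D * E)) := by
  rintro x ⟨_, ⟨d, hd, e, he, rfl⟩, hx⟩ y ⟨_, ⟨d', hd', e', he', rfl⟩, hy⟩
  obtain ⟨f, hf, h1, h2⟩ := hD d hd d' hd'
  obtain ⟨g, hg, h3, h4⟩ := hE e he e' he'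
  obtain ⟨f₁, hf₁, h5, -⟩ := hD f hf f hf
  obtain ⟨g₁, hg₁, h6, -⟩ := hE g hg g hg
  exact ⟨f * g, ⟨f₁ * g₁, Set.mul_mem_mul hf₁ hg₁, dom_mul h5 h6⟩,
    dom_trans (dom_mul h1 h3) hx, dom_trans (dom_mul h2 h4) hy⟩


/-- The set of non-empty directed cosets. -/
def DirCoset (T : StructuredSemigroup S) : Type _ := {C : T.Coset // T.Directed C.carrier}

/-- The part of the total space of the coset bundle which lies over the directed cosets. -/
def DirGerm (T : StructuredSemigroup S) : Type _ := {p : T.Germ // T.Directed p.base.carrier}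

/-- The directed cosets as a subgroupoid of the coset groupoid. -/
instance : ArrowGroupoid T.DirCoset :=
  ArrowGroupoid.restrict (fun C : T.Coset => T.Directed C.carrier) (fun _ h => h.dual)
    (fun _ _ _ h k => h.up_mul k)

instance : ArrowGroupoid T.DirGerm :=
  ArrowGroupoid.restrict (fun p : T.Germ => T.Directed p.base.carrier) (fun _ h => h.dual)
    (fun _ _ _ h k => h.up_mul k)

/-- The canonical topology on the cosets is generated by the sets `{C | a ∈ C}`. -/
instance : TopologicalSpace T.Coset :=
  TopologicalSpace.generateFrom (Set.range fun a : S => {C : T.Coset | a ∈ C.carrier})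

/-- The canonical topology on the total space of the coset bundle is generated by the sets
`{[s, C] | s ∈ C}` and `{[c, C] | c, s ∈ C}`, for `s ∈ S`. -/
instance : TopologicalSpace T.Germ :=
  TopologicalSpace.generateFrom
    ((Set.range fun s : S => {p : T.Germ | ∃ (C : T.Coset) (h : s ∈ C.carrier), p = Germ.germ C s h}) ∪
      Set.range fun s : S => {p : T.Germ | s ∈ p.base.carrier})

/-- The subspace topology. -/
instance : TopologicalSpace T.DirCoset :=
  inferInstanceAs (TopologicalSpace {C : T.Coset // T.Directed C.carrier})

instance : TopologicalSpace T.DirGerm :=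
  inferInstanceAs (TopologicalSpace {p : T.Germ // T.Directed p.base.carrier})

/-- The directed coset bundle: the restriction of the projection `[a, C] ↦ C`. -/
def dirProj (T : StructuredSemigroup S) (p : T.DirGerm) : T.DirCoset := ⟨p.1.base, p.2⟩

/-- The coset bundle representation takes `a` to the (graph of the) section `C ↦ [a, C]` defined on
the cosets `C` containing `a`. -/
def cosetRep (T : StructuredSemigroup S) (a : S) (p : T.Germ) (C : T.Coset) : Prop :=
  ∃ h : a ∈ C.carrier, p = Germ.germ C a h

/-- The directed coset bundle representation: the restriction of the coset bundle representation to
the directed cosets. -/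
def dirRep (T : StructuredSemigroup S) (a : S) (p : T.DirGerm) (D : T.DirCoset) : Prop :=
  T.cosetRep a p.1 D.1

/-! Representations. -/

/-- `Y` is symmetric: `a b ∈ Y` implies `b a b a ∈ Y`. -/
def IsSymmetric (Y : Set S) : Prop := ∀ a b : S, a * b ∈ Y → b * a * b * a ∈ Y

/-- `θ` is an étale representation of the structured semigroup on `G`: a semigroup homomorphism
from `S` to the open slices of the étale groupoid `G` which cover `G`, mapping `N` to sets of units,
and which is locally round. -/
structure IsEtaleRep {G : Type*} [TopologicalSpace G] [ArrowGroupoid G]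
    (T : StructuredSemigroup S) (θ : S → Set G) : Prop where
  isEtale : ArrowGroupoid.IsEtale G
  isOpen : ∀ a, IsOpen (θ a)
  isSlice : ∀ a, ArrowGroupoid.IsSlice (θ a)
  map_mul : ∀ a b, θ (a * b) = ArrowGroupoid.setMul (θ a) (θ b)
  covers : ∀ g, ∃ a, g ∈ θ a
  map_N : ∀ n ∈ T.N, θ n ⊆ ArrowGroupoid.units G
  locally_round : ∀ g a, g ∈ θ a → ∃ b, T.Dom b a ∧ g ∈ θ b

/-- `θ` is a bundle representation of the structured semigroup on the groupoid bundle `π`: a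
semigroup homomorphism from `S` to the slice-sections of `π` such that `a ↦ dom (θ a)` is an étale
representation. -/
structure IsBundleRep {F G : Type*} [TopologicalSpace F] [ArrowGroupoid F] [TopologicalSpace G]
    [ArrowGroupoid G] (T : StructuredSemigroup S) (π : F → G) (θ : S → F → G → Prop) : Prop where
  isGroupoidBundle : ArrowGroupoid.IsGroupoidBundle π
  isSliceSection : ∀ a, ArrowGroupoid.IsSliceSection π (θ a)
  map_mul : ∀ a b, θ (a * b) = ArrowGroupoid.sectionMul (θ a) (θ b)
  isEtaleRep : T.IsEtaleRep fun a => ArrowGroupoid.relDom (θ a)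

/-- The bundle representation `μ` on `π` is Zakrzewski-universal: every bundle representation `θ`
on a groupoid bundle `π'` is `τ/φ ∘ μ` for a unique Zakrzewski–Pierce morphism `(φ, τ)` from `π` to
`π'`. The universe levels `v'` and `w'` are those of the spaces of the bundle `π'`. -/
def IsZakrzewskiUniversal.{v', w', uF, uG, uS} {S : Type uS} [Semigroup S] {F : Type uF} {G : Type uG}
    [TopologicalSpace F] [ArrowGroupoid F] [TopologicalSpace G] [ArrowGroupoid G]
    (T : StructuredSemigroup S) (π : F → G) (μ : S → F → G → Prop) : Prop :=
  ∀ (F' : Type v') (G' : Type w') [TopologicalSpace F'] [ArrowGroupoid F'] [TopologicalSpace G']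
    [ArrowGroupoid G'] (π' : F' → G') (θ : S → F' → G' → Prop), T.IsBundleRep π' θ →
    ∃! m : ArrowGroupoid.ZPMorphism π π', ∀ a, θ a = m.transport (μ a)

end StructuredSemigroup

/-! A directed coset is a generalised point of S, and `a` stands for the open set D_a of the points
containing it. Directedness makes the sets D_a a basis, not just a subbasis. Everything about cosets
rests on two facts. Rigidity: a coset is determined by its source and one of its members
(`Coset.eq_of_src`), so each D_a is a slice. Translation: if U is a directed unit coset, bb' and b'b
lie in Z, and some m in U satisfies m(b'b) = m, then (bU)^< is a directed coset with source U
containing b (`Coset.exists_translate`). Translation makes the source map open. In the total space,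
a fixed representative `a` and one further condition on the base give arbitrarily small
neighbourhoods of [a, D] (`DirGerm.exists_subset_of_isOpen`), so the sections D ↦ [a, D] are
continuous and the projection is open.

The only delicate point in the representation property is multiplicativity: a directed D containing
ab must factor as A · B with a in A and b in B (`Coset.exists_mul_eq`). If c <_s ab with c in D,
take b' = sabsa. Then b'b = (sab)(sab) lies in Z, and bb' = (bs)a(bs)a lies in Z by symmetry,
applied to a(bs) in Z. Now B is the translate by b of the source of D, and A is D · B⁻¹.

For universality, let η(a) be the domain of θ(a). At a unit h, the elements n of N with h in η(n)
generate a directed unit coset U_h. Relate D to g when the source of D is U_{s(g)} and g lies in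
η(a) for one, equivalently every, a in D. Conjugation by members of D shows that the range of D is
U_{r(g)} (`IsEtaleRep.Classifies.rng_eq`), which yields functoriality; slices give star-bijectivity,
and translation gives continuity. Put τ([a, D], g) = θ(a)(g): if sat = sbt with s, t in D*, then
cancelling in F the values at g⁻¹ of θ(s) and θ(t) shows that the choice of `a` is irrelevant.

Uniqueness: the formula for τ is forced, and η(a) must be the preimage of D_a. Functoriality and
directedness then force the source of every D related to g to be U_{s(g)}, and rigidity does the
rest (`IsEtaleRep.eq_classifies`). -/

namespace ArrowGroupoid

/-! ### Cancellation and units for the partial product of a groupoid. -/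

section Algebra

variable {G : Type*} [ArrowGroupoid G] {g h k x y z : G}

theorem isMul_mul (g h : G) (e : src g = rng h) : IsMul g h (mul g h e) := ⟨e, rfl⟩

theorem isMul_src_right (g : G) : IsMul g (src g) g := ⟨_, mul_src g⟩

theorem isMul_rng_left (g : G) : IsMul (rng g) g g := ⟨_, rng_mul_self g⟩

theorem isMul_inv_right (g : G) : IsMul g (inv g) (rng g) := ⟨_, mul_inv g⟩

theorem isMul_inv_left (g : G) : IsMul (inv g) g (src g) := ⟨_, inv_mul g⟩

theorem IsMul.unique (hx : IsMul g h x) (hy : IsMul g h y) : x = y := by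
  obtain ⟨_, rfl⟩ := hx; obtain ⟨_, rfl⟩ := hy; rfl

theorem IsMul.rng_eq (hx : IsMul g h x) : rng x = rng g := by
  obtain ⟨_, rfl⟩ := hx; exact rng_mul _ _ _

theorem IsMul.assoc (h₁ : IsMul g h x) (h₂ : IsMul x k y) (h₃ : IsMul h k z) : IsMul g z y := by
  obtain ⟨e₁, rfl⟩ := h₁
  obtain ⟨_, rfl⟩ := h₂
  obtain ⟨e₃, rfl⟩ := h₃
  exact ⟨e₁.trans (rng_mul h k e₃).symm, (mul_assoc g h k e₁ e₃).symm⟩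

theorem IsMul.assoc' (h₁ : IsMul h k z) (h₂ : IsMul g z y) (h₃ : IsMul g h x) : IsMul x k y := by
  obtain ⟨e₁, rfl⟩ := h₁
  obtain ⟨_, rfl⟩ := h₂
  obtain ⟨e₃, rfl⟩ := h₃
  exact ⟨(src_mul g h e₃).trans e₁, mul_assoc g h k e₃ e₁⟩

theorem IsMul.inv_mul (hx : IsMul g h x) : IsMul (ArrowGroupoid.inv g) x h := by
  refine (isMul_inv_left g).assoc ?_ hx
  rw [hx.choose]
  exact isMul_rng_left h

theorem IsMul.mul_inv (hx : IsMul g h x) : IsMul x (ArrowGroupoid.inv h) g := by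
  refine (isMul_inv_right h).assoc' ?_ hx
  rw [← hx.choose]
  exact isMul_src_right g

theorem IsMul.left_cancel (hx : IsMul g x k) (hy : IsMul g y k) : x = y :=
  hx.inv_mul.unique hy.inv_mul

theorem IsMul.right_cancel (hx : IsMul x g k) (hy : IsMul y g k) : x = y :=
  hx.mul_inv.unique hy.mul_inv

theorem inv_inv (g : G) : inv (inv g) = g := by
  refine (isMul_inv_left (inv g)).right_cancel ?_
  rw [src_inv]; exact isMul_inv_right g

theorem src_src (g : G) : src (src g) = src g := by
  conv_lhs => rw [← rng_src g, src_rng]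
  exact rng_src g

theorem rng_rng (g : G) : rng (rng g) = rng g := by
  conv_lhs => rw [← src_rng g, rng_src]
  exact src_rng g

theorem mem_units : g ∈ units G ↔ src g = g := by
  refine ⟨fun h => ?_, fun h => ?_⟩
  · exact (isMul_src_right g).left_cancel h
  · have := isMul_src_right g
    rwa [h] at this

theorem rng_of_mem_units (h : g ∈ units G) : rng g = g := by
  rw [← mem_units.1 h, rng_src]

theorem src_mem_units (g : G) : src g ∈ units G := mem_units.2 (src_src g)

theorem rng_mem_units (g : G) : rng g ∈ units G := mem_units.2 (src_rng g)

theorem IsMul.eq_of_left_mem_units (hx : IsMul g h x) (hg : g ∈ units G) : h = x ∧ g = rng h := by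
  have e : g = rng h := by rw [← hx.choose, mem_units.1 hg]
  subst e
  exact ⟨(isMul_rng_left h).unique hx, rfl⟩

theorem IsMul.eq_inv_of_mem_units (hx : IsMul g h x) (hu : x ∈ units G) : h = inv g ∧ x = rng g := by
  have e : x = rng g := by rw [← hx.rng_eq, rng_of_mem_units hu]
  subst e
  exact ⟨hx.left_cancel (isMul_inv_right g), rfl⟩

end Algebra

end ArrowGroupoid

/-! ### Domination below elements of N. -/

namespace StructuredSemigroup
variable {S : Type*} [Semigroup S] {T : StructuredSemigroup S}

/-- If a <_s n, then a = (as)n is a product of two elements of N. -/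
theorem Dom.mem_N {a n : S} (h : T.Dom a n) (hn : n ∈ T.N) : a ∈ T.N := by
  obtain ⟨s, h⟩ := h
  rw [← h.left]
  exact T.N.mul_mem h.as_mem hn

/-- An element of `N` is dominated by every element of `Z` fixing it. -/
theorem dom_of_mul_eq {n z : S} (hn : n ∈ T.N) (hz : z ∈ T.Z) (e : n * z = n) : T.Dom n z :=
  ⟨z, .of_left (by rw [e, e]) (by rwa [e]) (T.Z.mul_mem hz hz) (T.Z.mul_mem hz hz)⟩

/-- If `b < n` and `c < m` in `N` then `b b c < n`. -/
theorem DomVia.sq_mul {b s n c : S} (h : T.DomVia s b n) (hn : n ∈ T.N) (hc : c ∈ T.N) :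
    T.DomVia s (b * b * c) n := by
  have hb : b ∈ T.N := Dom.mem_N ⟨s, h⟩ hn
  have hk : b * c ∈ T.N := T.N.mul_mem hb hc
  have e : s * n * b = b := by rw [T.Z_comm _ h.sb_mem _ hb, ← mul_assoc, h.left]
  have e₁ : s * n * (b * c) = b * c := by rw [← mul_assoc, e]
  have e₂ : b * c * (s * n) = b * c := by rw [← T.Z_comm _ h.sb_mem _ hk, e₁]
  -- Trinormality moves bc to n(bc)s in N. Multiplying by bs on the left and using bsn = b gives
  -- bbcs in N; this is the purpose of the second factor b.
  have h₁ := T.trinormal s n (b * c) hk e₁ (by rw [mul_assoc, e₂]) h.sb_mem h.bs_mem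
  have h₂ := T.N.mul_mem h.as_mem h₁
  refine .of_left ?_ ?_ h.bs_mem h.sb_mem
  · calc b * b * c * s * n = b * (b * c * (s * n)) := by simp only [mul_assoc]
      _ = _ := by rw [e₂, mul_assoc]
  · have : b * s * (n * (b * c) * s) = b * b * c * s := by
      calc _ = b * s * n * (b * c) * s := by simp only [mul_assoc]
        _ = _ := by rw [h.left]; simp only [mul_assoc]
    rwa [this] at h₂

/-! ### Rigidity, translation and factorisation of cosets. -/

namespace Coset

theorem mem_of_dom {C : T.Coset} {a b : S} (ha : a ∈ C.carrier) (h : T.Dom a b) :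
    b ∈ C.carrier := by
  rw [C.isCoset.2]; exact ⟨a, ha, h⟩

theorem exists_dom {C : T.Coset} {a : S} (ha : a ∈ C.carrier) : ∃ b ∈ C.carrier, T.Dom b a := by
  obtain ⟨b, hb, c, -, k⟩ := C.isCoset.exists_dom ha
  exact ⟨b, hb, c, k⟩

theorem mul_mem_src {C : T.Coset} {a b : S} (ha : a ∈ T.dual C.carrier) (hb : b ∈ C.carrier) :
    a * b ∈ (ArrowGroupoid.src C).carrier :=
  subset_up_mul C.inv.isCoset.2.subset C.isCoset.2.subset (Set.mul_mem_mul ha hb)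

theorem mul_mem_rng {C : T.Coset} {a b : S} (ha : a ∈ C.carrier) (hb : b ∈ T.dual C.carrier) :
    a * b ∈ (ArrowGroupoid.rng C).carrier :=
  subset_up_mul C.isCoset.2.subset C.inv.isCoset.2.subset (Set.mul_mem_mul ha hb)

theorem mul_mem_of_src {C : T.Coset} {a b : S} (ha : a ∈ C.carrier)
    (hb : b ∈ (ArrowGroupoid.src C).carrier) : a * b ∈ C.carrier :=
  Germ.mul_mem' (ArrowGroupoid.rng_src C).symm (ArrowGroupoid.mul_src C) ha hb

theorem mul_mem_of_rng {C : T.Coset} {a b : S} (ha : a ∈ (ArrowGroupoid.rng C).carrier)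
    (hb : b ∈ C.carrier) : a * b ∈ C.carrier :=
  Germ.mul_mem' (ArrowGroupoid.src_rng C) (ArrowGroupoid.rng_mul_self C) ha hb

/-- Given x in A, take y < x in A and d <_{a'} a in A. Then a'y lies in the source of A, hence of B,
so aa'y lies in B; it is still dominated by x because aa' is in Z. -/
theorem subset_of_src {A B : T.Coset} {a : S} (hA : a ∈ A.carrier) (hB : a ∈ B.carrier)
    (h : (ArrowGroupoid.src A).carrier ⊆ (ArrowGroupoid.src B).carrier) :
    A.carrier ⊆ B.carrier := by
  intro x hx
  obtain ⟨d, hd, a', ha', k⟩ := A.isCoset.exists_dom hA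
  obtain ⟨y, hy, s, l⟩ := exists_dom hx
  have h₁ := mul_mem_of_src hB (h (mul_mem_src ha' hy))
  rw [← mul_assoc] at h₁
  exact mem_of_dom h₁ ⟨s, l.N_mul (T.Z_le k.bs_mem)⟩

theorem subset_of_rng {A B : T.Coset} {a : S} (hA : a ∈ A.carrier) (hB : a ∈ B.carrier)
    (h : (ArrowGroupoid.rng A).carrier ⊆ (ArrowGroupoid.rng B).carrier) :
    A.carrier ⊆ B.carrier := by
  intro x hx
  obtain ⟨d, hd, a', ha', k⟩ := A.isCoset.exists_dom hA
  obtain ⟨y, hy, s, l⟩ := exists_dom hx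
  have h₁ := mul_mem_of_rng (h (mul_mem_rng hy ha')) hB
  rw [mul_assoc] at h₁
  exact mem_of_dom h₁ ⟨s, l.mul_N (T.Z_le k.sb_mem)⟩

theorem eq_of_src {A B : T.Coset} {a : S} (hA : a ∈ A.carrier) (hB : a ∈ B.carrier)
    (h : ArrowGroupoid.src A = ArrowGroupoid.src B) : A = B :=
  Coset.ext ((subset_of_src hA hB (h ▸ subset_rfl)).antisymm
    (subset_of_src hB hA (h ▸ subset_rfl)))

theorem eq_of_rng {A B : T.Coset} {a : S} (hA : a ∈ A.carrier) (hB : a ∈ B.carrier)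
    (h : ArrowGroupoid.rng A = ArrowGroupoid.rng B) : A = B :=
  Coset.ext ((subset_of_rng hA hB (h ▸ subset_rfl)).antisymm
    (subset_of_rng hB hA (h ▸ subset_rfl)))

/-- A coset containing an element of `N` is a unit. -/
theorem src_eq_of_mem_N {C : T.Coset} {n : S} (hn : n ∈ T.N) (hC : n ∈ C.carrier) :
    ArrowGroupoid.src C = C := by
  obtain ⟨d, hd, n', hn', k⟩ := C.isCoset.exists_dom hC
  -- The element n'n belongs both to C and to its source. These two cosets have the same source, so
  -- rigidity identifies them.
  have h₁ : n' * n ∈ C.carrier := mem_of_dom hd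
    (dom_of_mul_eq (Dom.mem_N ⟨_, k⟩ hn) k.sb_mem (by rw [← mul_assoc, k.left]))
  have h₂ : n' * n ∈ (ArrowGroupoid.src C).carrier := mem_of_dom (mul_mem_src hn' hd)
    (dom_of_mul_eq k.sa_mem k.sb_mem (by rw [mul_assoc, ← mul_assoc d, k.left]))
  exact eq_of_src h₂ h₁ (ArrowGroupoid.src_src C)

theorem dual_of_src_eq {U : T.Coset} (hU : ArrowGroupoid.src U = U) :
    T.dual U.carrier = U.carrier :=
  congrArg Coset.carrier (ArrowGroupoid.inv_eq_of_src hU)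

/-- Translating a directed unit coset `U` by `b` yields a directed coset with source `U`. -/
theorem exists_translate {U : T.Coset} (hU : ArrowGroupoid.src U = U) (hD : T.Directed U.carrier)
    {b b' m : S} (hb : b * b' ∈ T.Z) (hb' : b' * b ∈ T.Z) (hm : m ∈ U.carrier)
    (e : m * (b' * b) = m) :
    ∃ B : T.Coset, T.Directed B.carrier ∧ ArrowGroupoid.src B = U ∧ b ∈ B.carrier ∧
      b' ∈ T.dual B.carrier := by
  obtain ⟨m, hm, hmN, e⟩ := Germ.unit_fix hU hm e
  have hUd := dual_of_src_eq hU
  have hmul : ∀ {x y}, x ∈ U.carrier → y ∈ U.carrier → x * y ∈ U.carrier := Germ.unit_mul hU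
  have e' : b' * b * m = m := by rw [T.Z_comm _ hb' _ hmN, e]
  have k : T.DomVia b' (b * m) b := .of_right
    (by rw [mul_assoc, ← mul_assoc b', e']) (by rwa [← mul_assoc, e']) hb hb'
  have k' : T.DomVia b (m * b') b' := .of_left
    (by rw [mul_assoc m, e]) (by rwa [mul_assoc, e]) hb' hb
  -- The set bU is an atlas, and its up-closure is the required coset.
  let A : Set S := (fun x => b * x) '' U.carrier
  have memA : ∀ {x}, x ∈ U.carrier → b * x ∈ A := fun hx => ⟨_, hx, rfl⟩
  -- The element mb' lies below b' via b, so sb is in the dual of (mb')(bU). Since mb'b = m, that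
  -- product is mU, which lies inside U, and U is its own dual.
  have dA : ∀ {s}, s ∈ T.dual A → s * b ∈ U.carrier := by
    intro s hs
    have h₁ := dual_mul_dual (T := T) A {m * b'}
      (Set.mul_mem_mul hs (show b ∈ T.dual {m * b'} from ⟨_, rfl, _, k'⟩))
    rw [← hUd]
    refine dual_mono ?_ h₁
    rintro _ ⟨_, rfl, _, ⟨x, hx, rfl⟩, rfl⟩
    have : m * b' * (b * x) = m * x := by
      rw [← mul_assoc, mul_assoc m, e]
    change m * b' * (b * x) ∈ U.carrier
    rw [this]
    exact hmul hm hx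
  -- Domination in U is carried over to bU by inserting m, because bm < b.
  have dom : ∀ {x y}, T.Dom x y → T.Dom (b * (m * x)) (b * y) := by
    intro x y h
    rw [← mul_assoc]
    exact dom_mul ⟨_, k⟩ h
  have hA : T.IsAtlas A := by
    constructor
    · rintro _ ⟨_, ⟨_, ⟨x, hx, rfl⟩, s, hs, rfl⟩, _, ⟨y, hy, rfl⟩, rfl⟩
      have := memA (hmul (hmul hx (dA hs)) hy)
      simpa only [mul_assoc] using this
    · rintro _ ⟨x, hx, rfl⟩
      obtain ⟨y, hy, l⟩ := exists_dom hx
      exact ⟨_, memA (hmul hm hy), dom l⟩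
  have hbB : b ∈ T.up A := ⟨_, memA hm, _, k⟩
  let B : T.Coset := ⟨T.up A, hA.isCoset_up, b, hbB⟩
  have hb'B : b' ∈ T.dual B.carrier := ⟨_, hA.2 (memA hm), _, k⟩
  refine ⟨B, ?_, ?_, hbB, hb'B⟩
  · rintro x ⟨_, ⟨u, hu, rfl⟩, hx⟩ y ⟨_, ⟨v, hv, rfl⟩, hy⟩
    obtain ⟨w, hw, h₁, h₂⟩ := hD u hu v hv
    exact ⟨_, hA.2 (memA (hmul hm hw)), dom_trans (dom h₁) hx, dom_trans (dom h₂) hy⟩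
  · refine Coset.ext (Set.Subset.antisymm ?_ fun u hu => ?_)
    · rintro x ⟨_, ⟨s, hs, y, ⟨_, ⟨u, hu, rfl⟩, hy⟩, rfl⟩, hx⟩
      obtain ⟨t, ht, l⟩ := exists_dom (C := B.inv) hs
      have ht' : t ∈ T.dual A := hA.dual_up ▸ ht
      have := hmul (dA ht') hu
      rw [mul_assoc] at this
      exact mem_of_dom this (dom_trans (dom_mul l hy) hx)
    · obtain ⟨v, hv, s, l⟩ := exists_dom hu
      have h₁ := mul_mem_src hb'B (hA.2 (memA (hmul hm hv)))
      have h₂ : b' * (b * (m * v)) = m * v := by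
        rw [← mul_assoc, ← mul_assoc, e']
      rw [h₂] at h₁
      exact mem_of_dom h₁ ⟨s, l.N_mul hmN⟩

/-- If `Z` is symmetric, a directed coset containing `a b` is a product of directed cosets
containing `a` and `b`. -/
theorem exists_mul_eq (hZ : IsSymmetric (T.Z : Set S)) {D : T.Coset} (hD : T.Directed D.carrier)
    {a b : S} (hab : a * b ∈ D.carrier) :
    ∃ A B : T.Coset, T.Directed A.carrier ∧ T.Directed B.carrier ∧ a ∈ A.carrier ∧
      b ∈ B.carrier ∧ ArrowGroupoid.IsMul A B D := by
  obtain ⟨c, hc, s, hs, k⟩ := D.isCoset.exists_dom hab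
  have hsab : s * a * b ∈ T.Z := by rw [mul_assoc]; exact k.sb_mem
  have habs : a * (b * s) ∈ T.Z := by rw [← mul_assoc]; exact k.bs_mem
  -- Symmetry enters here, applied to the product of a and bs. It makes b' = sabsa a two-sided
  -- Z-partner of b.
  have hz : b * s * a * (b * s) * a ∈ T.Z := hZ _ _ habs
  have h₁ : b * (s * a * b * s * a) ∈ T.Z := by simpa only [mul_assoc] using hz
  have h₂ : s * a * b * s * a * b ∈ T.Z := by
    simpa only [mul_assoc] using T.Z.mul_mem hsab hsab
  have e₀ : c * s * a * b = c := by rw [mul_assoc _ a, k.left]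
  have e₁ : s * c * (s * a * b * s * a * b) = s * c := by
    calc _ = s * (c * s * a * b * s * a * b) := by simp only [mul_assoc]
      _ = _ := by rw [e₀, e₀]
  have hdir : T.Directed (ArrowGroupoid.src D).carrier := hD.dual.up_mul hD
  obtain ⟨B, hB, hsrc, hbB, hb'⟩ := exists_translate (ArrowGroupoid.src_src D) hdir h₁ h₂
    (mul_mem_src hs hc) e₁
  have hDB : ArrowGroupoid.src D = ArrowGroupoid.rng (ArrowGroupoid.inv B) := by
    rw [ArrowGroupoid.rng_inv, hsrc]
  have hm := ArrowGroupoid.isMul_mul D (ArrowGroupoid.inv B) hDB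
  refine ⟨ArrowGroupoid.mul D (ArrowGroupoid.inv B) hDB, B, hD.up_mul hB.dual, hB, ?_, hbB, ?_⟩
  · refine ⟨c * (s * a * b * s * a), Set.mul_mem_mul hc hb', b * s * a * (b * s), ?_⟩
    have e₂ : c * (s * a * b * s * a) = c * s * a := by
      calc _ = c * s * a * b * s * a := by simp only [mul_assoc]
        _ = _ := by rw [e₀]
    have e₃ : c * s * (a * (b * s)) = c * s := by
      calc _ = c * s * a * b * s := by simp only [mul_assoc]
        _ = _ := by rw [e₀]
    have e₄ : c * s * a * (b * s * a * (b * s)) = c * s := by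
      calc _ = c * s * (a * (b * s)) * (a * (b * s)) := by simp only [mul_assoc]
        _ = _ := by rw [e₃, e₃]
    rw [e₂]
    refine .of_left (by rw [e₄]) (by rw [e₄]; exact k.as_mem) ?_ hz
    simpa only [mul_assoc] using T.Z.mul_mem habs habs
  · have := hm.mul_inv
    rwa [ArrowGroupoid.inv_inv] at this

end Coset

end StructuredSemigroup

/-! ### The étale groupoid of directed cosets. -/

namespace StructuredSemigroup
variable {S : Type*} [Semigroup S] {T : StructuredSemigroup S}

open ArrowGroupoid Topology

theorem Germ.isMul_base {p q r : T.Germ} (h : IsMul p q r) : IsMul p.base q.base r.base := by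
  obtain ⟨e, rfl⟩ := h; exact ⟨_, rfl⟩

theorem Germ.mul_mem_of_isMul {p q r : T.Germ} (h : IsMul p q r) {a b : S} (ha : a ∈ p.cls)
    (hb : b ∈ q.cls) : a * b ∈ r.cls := by
  obtain ⟨e, rfl⟩ := h; exact Germ.mul_mem _ ha hb

theorem Germ.mem_germ {C : T.Coset} {a : S} (ha : a ∈ C.carrier) : a ∈ (Germ.germ C a ha).cls :=
  ⟨ha, Rel.refl C.isCoset ha a⟩

namespace DirCoset

theorem isMul_iff {A B C : T.DirCoset} : IsMul A B C ↔ IsMul A.1 B.1 C.1 :=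
  ⟨fun ⟨e, h⟩ => ⟨congrArg Subtype.val e, congrArg Subtype.val h⟩,
    fun ⟨e, h⟩ => ⟨Subtype.ext e, Subtype.ext h⟩⟩

theorem eq_of_src {A B : T.DirCoset} {a : S} (hA : a ∈ A.1.carrier) (hB : a ∈ B.1.carrier)
    (h : src A = src B) : A = B :=
  Subtype.ext (Coset.eq_of_src hA hB (congrArg Subtype.val h))

theorem eq_of_rng {A B : T.DirCoset} {a : S} (hA : a ∈ A.1.carrier) (hB : a ∈ B.1.carrier)
    (h : rng A = rng B) : A = B :=
  Subtype.ext (Coset.eq_of_rng hA hB (congrArg Subtype.val h))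

theorem src_eq_of_mem_N {D : T.DirCoset} {n : S} (hn : n ∈ T.N) (hD : n ∈ D.1.carrier) :
    src D = D :=
  Subtype.ext (Coset.src_eq_of_mem_N hn hD)

theorem isSlice (a : S) : IsSlice {D : T.DirCoset | a ∈ D.1.carrier} :=
  ⟨fun _ hA _ hB h => eq_of_src hA hB h, fun _ hA _ hB h => eq_of_rng hA hB h⟩

theorem exists_translate {U : T.DirCoset} (hU : src U = U) {b b' m : S} (hb : b * b' ∈ T.Z)
    (hb' : b' * b ∈ T.Z) (hm : m ∈ U.1.carrier) (e : m * (b' * b) = m) :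
    ∃ B : T.DirCoset, src B = U ∧ b ∈ B.1.carrier ∧ b' ∈ T.dual B.1.carrier := by
  obtain ⟨B, h₁, h₂, h₃, h₄⟩ :=
    Coset.exists_translate (congrArg Subtype.val hU) U.2 hb hb' hm e
  exact ⟨⟨B, h₁⟩, Subtype.ext h₂, h₃, h₄⟩

theorem isOpen_mem (a : S) : IsOpen {D : T.DirCoset | a ∈ D.1.carrier} :=
  ⟨{C : T.Coset | a ∈ C.carrier}, .basic _ ⟨a, rfl⟩, rfl⟩

theorem mem_nhds {D : T.DirCoset} {a : S} (ha : a ∈ D.1.carrier) :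
    {E : T.DirCoset | a ∈ E.1.carrier} ∈ 𝓝 D := (isOpen_mem a).mem_nhds ha

/-- The one place where directedness matters is a finite intersection: a common lower bound d of two
members of D is in D, and any coset containing d contains both. -/
theorem exists_subset_of_isOpen {O : Set T.DirCoset} (hO : IsOpen O) {D : T.DirCoset}
    (hD : D ∈ O) : ∃ a ∈ D.1.carrier, ∀ E : T.DirCoset, a ∈ E.1.carrier → E ∈ O := by
  obtain ⟨V, hV, rfl⟩ := hO
  induction hV with
  | basic _ h =>
    obtain ⟨a, rfl⟩ := h
    exact ⟨a, hD, fun _ h => h⟩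
  | univ =>
    obtain ⟨a, ha⟩ := D.1.nonempty
    exact ⟨a, ha, fun _ _ => trivial⟩
  | inter V W _ _ hV hW =>
    obtain ⟨a, ha, h₁⟩ := hV hD.1
    obtain ⟨b, hb, h₂⟩ := hW hD.2
    obtain ⟨d, hd, k₁, k₂⟩ := D.2 a ha b hb
    exact ⟨d, hd, fun E hE => ⟨h₁ E (Coset.mem_of_dom hE k₁), h₂ E (Coset.mem_of_dom hE k₂)⟩⟩
  | sUnion s _ hs =>
    obtain ⟨V, hV, hDV⟩ := hD
    obtain ⟨a, ha, h⟩ := hs V hV hDV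
    exact ⟨a, ha, fun E hE => ⟨V, hV, h E hE⟩⟩

theorem continuous_of_nhds {X : Type*} [TopologicalSpace X] {f : X → T.DirCoset}
    (h : ∀ x, ∀ a ∈ (f x).1.carrier, {y | a ∈ (f y).1.carrier} ∈ 𝓝 x) : Continuous f := by
  refine continuous_def.2 fun O hO => isOpen_iff_mem_nhds.2 fun x hx => ?_
  obtain ⟨a, ha, hs⟩ := exists_subset_of_isOpen hO hx
  exact Filter.mem_of_superset (h x a ha) fun y hy => hs _ hy

theorem mem_inv_nhds {D : T.DirCoset} {a : S} (ha : a ∈ (inv D).1.carrier) :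
    {E : T.DirCoset | a ∈ (inv E).1.carrier} ∈ 𝓝 D := by
  obtain ⟨d, hd, b, k⟩ := ha
  exact Filter.mem_of_superset (mem_nhds hd) fun E hE => ⟨d, hE, b, k⟩

theorem isEtale : IsEtale T.DirCoset where
  continuous_inv := continuous_of_nhds fun _ _ ha => mem_inv_nhds ha
  continuous_mul := by
    refine continuous_of_nhds ?_
    rintro ⟨⟨A, B⟩, e⟩ x ⟨_, ⟨a, ha, b, hb, rfl⟩, hx⟩
    have h₁ := (continuous_fst.comp continuous_subtype_val).continuousAt.preimage_mem_nhds
      (x := (⟨(A, B), e⟩ : {p : T.DirCoset × T.DirCoset // src p.1 = rng p.2})) (mem_nhds ha)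
    have h₂ := (continuous_snd.comp continuous_subtype_val).continuousAt.preimage_mem_nhds
      (x := (⟨(A, B), e⟩ : {p : T.DirCoset × T.DirCoset // src p.1 = rng p.2})) (mem_nhds hb)
    filter_upwards [h₁, h₂] with p hp hq
    exact ⟨a * b, Set.mul_mem_mul hp hq, hx⟩
  isOpenMap_src := by
    intro O hO
    refine isOpen_iff_mem_nhds.2 ?_
    rintro _ ⟨D, hD, rfl⟩
    obtain ⟨a, ha, hs⟩ := exists_subset_of_isOpen hO hD
    obtain ⟨d, hd, a', ha', k⟩ := D.1.isCoset.exists_dom ha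
    -- Since a'd is in N, every coset E containing it is a unit; translating E by a gives a preimage
    -- of E under the source map that contains a.
    have hm : a' * d ∈ (src D).1.carrier := Coset.mul_mem_src ha' hd
    refine Filter.mem_of_superset (mem_nhds hm) fun E hE => ?_
    obtain ⟨B, hB, haB, -⟩ := exists_translate (src_eq_of_mem_N k.sa_mem hE) k.bs_mem k.sb_mem hE
      (by rw [_root_.mul_assoc, ← _root_.mul_assoc d, k.left])
    exact ⟨B, hs B haB, hB⟩

end DirCoset

/-! ### The directed coset bundle. -/

namespace DirGerm

theorem isMul_iff {p q r : T.DirGerm} : IsMul p q r ↔ IsMul p.1 q.1 r.1 :=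
  ⟨fun ⟨e, h⟩ => ⟨congrArg Subtype.val e, congrArg Subtype.val h⟩,
    fun ⟨e, h⟩ => ⟨Subtype.ext e, Subtype.ext h⟩⟩

/-- The element `[a, D]` over a directed coset `D`. -/
def germ (D : T.DirCoset) (a : S) (ha : a ∈ D.1.carrier) : T.DirGerm := ⟨Germ.germ D.1 a ha, D.2⟩

theorem ext_of_mem {p q : T.DirGerm} {a : S} (h : T.dirProj p = T.dirProj q) (hp : a ∈ p.1.cls)
    (hq : a ∈ q.1.cls) : p = q :=
  Subtype.ext (Germ.ext_of_mem (congrArg Subtype.val h) hp hq)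

theorem isOpen_base (a : S) : IsOpen {p : T.DirGerm | a ∈ p.1.base.carrier} :=
  ⟨{p : T.Germ | a ∈ p.base.carrier}, .basic _ (Or.inr ⟨a, rfl⟩), rfl⟩

theorem isOpen_cls (a : S) : IsOpen {p : T.DirGerm | a ∈ p.1.cls} := by
  refine ⟨{p : T.Germ | ∃ (C : T.Coset) (h : a ∈ C.carrier), p = Germ.germ C a h},
    .basic _ (Or.inl ⟨a, rfl⟩), ?_⟩
  ext p
  refine ⟨?_, fun h => ⟨p.1.base, Germ.mem_base h, Germ.ext_of_mem rfl h (Germ.mem_germ _)⟩⟩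
  rintro ⟨C, h, e⟩
  change a ∈ p.1.cls
  rw [e]
  exact Germ.mem_germ h

theorem base_mem_nhds {p : T.DirGerm} {a : S} (h : a ∈ p.1.base.carrier) :
    {q : T.DirGerm | a ∈ q.1.base.carrier} ∈ 𝓝 p := (isOpen_base a).mem_nhds h

theorem cls_mem_nhds {p : T.DirGerm} {a : S} (h : a ∈ p.1.cls) :
    {q : T.DirGerm | a ∈ q.1.cls} ∈ 𝓝 p := (isOpen_cls a).mem_nhds h

/-- The representative `a` can be fixed in advance. If s ~ a is witnessed by u, v in D*, finitely
many members of D force u and v to be in the dual of the base, and directedness replaces these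
members, together with s, by a single one. The same u, v then witness s ~ a over every nearby base.
-/
theorem exists_subset_of_isOpen {O : Set T.DirGerm} (hO : IsOpen O) {p : T.DirGerm}
    (hp : p ∈ O) {a : S} (ha : a ∈ p.1.cls) :
    ∃ e ∈ p.1.base.carrier, ∀ q : T.DirGerm, a ∈ q.1.cls → e ∈ q.1.base.carrier → q ∈ O := by
  obtain ⟨V, hV, rfl⟩ := hO
  induction hV with
  | basic _ h =>
    obtain ⟨s, rfl⟩ | ⟨s, rfl⟩ := h
    · obtain ⟨C, h, e⟩ := hp
      have hs : s ∈ p.1.cls := e ▸ Germ.mem_germ h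
      obtain ⟨u, ⟨u₁, hu, u₂, ku⟩, v, ⟨v₁, hv, v₂, kv⟩, k⟩ := Germ.rel ha hs
      obtain ⟨d, hd, k₁, k₂⟩ := p.2 u₁ hu v₁ hv
      obtain ⟨c, hc, k₃, k₄⟩ := p.2 d hd s (Germ.mem_base hs)
      refine ⟨c, hc, fun q hq hcq => ?_⟩
      have hsq := Coset.mem_of_dom hcq k₄
      have hdq := Coset.mem_of_dom hcq k₃
      have : s ∈ q.1.cls := Germ.mem_of_rel hq hsq
        ⟨u, ⟨u₁, Coset.mem_of_dom hdq k₁, u₂, ku⟩, v, ⟨v₁, Coset.mem_of_dom hdq k₂, v₂, kv⟩, k⟩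
      exact ⟨q.1.base, hsq, Germ.ext_of_mem rfl this (Germ.mem_germ _)⟩
    · exact ⟨s, hp, fun _ _ h => h⟩
  | univ => exact ⟨a, Germ.mem_base ha, fun _ _ _ => trivial⟩
  | inter V W _ _ hV hW =>
    obtain ⟨b, hb, h₁⟩ := hV hp.1
    obtain ⟨c, hc, h₂⟩ := hW hp.2
    obtain ⟨d, hd, k₁, k₂⟩ := p.2 b hb c hc
    exact ⟨d, hd, fun q hq hdq => ⟨h₁ q hq (Coset.mem_of_dom hdq k₁),
      h₂ q hq (Coset.mem_of_dom hdq k₂)⟩⟩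
  | sUnion s _ hs =>
    obtain ⟨V, hV, hpV⟩ := hp
    obtain ⟨e, he, h⟩ := hs V hV hpV
    exact ⟨e, he, fun q hq heq => ⟨V, hV, h q hq heq⟩⟩

/-- Continuity thus needs only one representative of f x, besides control of the base. -/
theorem continuous_of_nhds {X : Type*} [TopologicalSpace X] {f : X → T.DirGerm}
    (h : ∀ x, ∃ a ∈ (f x).1.cls, {y | a ∈ (f y).1.cls} ∈ 𝓝 x)
    (h' : ∀ x, ∀ a ∈ (f x).1.base.carrier, {y | a ∈ (f y).1.base.carrier} ∈ 𝓝 x) :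
    Continuous f := by
  refine continuous_def.2 fun O hO => isOpen_iff_mem_nhds.2 fun x hx => ?_
  obtain ⟨a, ha, hn⟩ := h x
  obtain ⟨e, he, hs⟩ := exists_subset_of_isOpen hO hx ha
  filter_upwards [hn, h' x e he] with y h₁ h₂ using hs _ h₁ h₂

theorem continuous_dirProj : Continuous T.dirProj :=
  DirCoset.continuous_of_nhds fun _ _ ha => base_mem_nhds ha

theorem isTopGroupoid : IsTopGroupoid T.DirGerm where
  continuous_inv := by
    refine continuous_of_nhds (fun p => ?_) fun p a ha => ?_
    · obtain ⟨c, hc⟩ := p.1.nonempty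
      obtain ⟨d, hd, c', hc', k⟩ := p.1.base.isCoset.exists_dom (Germ.mem_base hc)
      refine ⟨c', Germ.inv_mem hc hd k, ?_⟩
      filter_upwards [cls_mem_nhds hc, base_mem_nhds hd] with q h₁ h₂ using Germ.inv_mem h₁ h₂ k
    · obtain ⟨d, hd, b, k⟩ := ha
      filter_upwards [base_mem_nhds hd] with q hq using ⟨d, hq, b, k⟩
  continuous_mul := by
    have c₁ : Continuous fun x : {p : T.DirGerm × T.DirGerm // src p.1 = rng p.2} => x.1.1 :=
      continuous_fst.comp continuous_subtype_val
    have c₂ : Continuous fun x : {p : T.DirGerm × T.DirGerm // src p.1 = rng p.2} => x.1.2 :=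
      continuous_snd.comp continuous_subtype_val
    refine continuous_of_nhds (fun x => ?_) fun x z hz => ?_
    · obtain ⟨a, ha⟩ := x.1.1.1.nonempty
      obtain ⟨b, hb⟩ := x.1.2.1.nonempty
      refine ⟨a * b, Germ.mul_mem _ ha hb, ?_⟩
      filter_upwards [c₁.continuousAt.preimage_mem_nhds (cls_mem_nhds ha),
        c₂.continuousAt.preimage_mem_nhds (cls_mem_nhds hb)] with y h₁ h₂ using Germ.mul_mem _ h₁ h₂
    · obtain ⟨_, ⟨a, ha, b, hb, rfl⟩, hz⟩ := hz
      filter_upwards [c₁.continuousAt.preimage_mem_nhds (base_mem_nhds ha),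
        c₂.continuousAt.preimage_mem_nhds (base_mem_nhds hb)] with y h₁ h₂
      exact ⟨a * b, Set.mul_mem_mul h₁ h₂, hz⟩

theorem isFunctor_dirProj : IsFunctor T.dirProj := fun _ _ _ h =>
  DirCoset.isMul_iff.2 (Germ.isMul_base (isMul_iff.1 h))

theorem isGroupoidBundle : IsGroupoidBundle T.dirProj where
  isTopGroupoid := isTopGroupoid
  isEtale := DirCoset.isEtale
  isFunctor := isFunctor_dirProj
  injOn_units := by
    intro p hp q hq h
    rw [mem_units] at hp hq
    have h' : p.1.base = q.1.base := congrArg Subtype.val h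
    -- A unit of the total space is the class of any z in Z with xz = x for some x in its base, so
    -- it depends on the base alone.
    obtain ⟨z, hz, x, hx, e⟩ := Germ.exists_fix p.1.base.src
    rw [← hp, ← hq]
    refine Subtype.ext (Germ.ext_of_mem (congrArg Coset.src h')
      (Germ.unit_mem_cls (Germ.src_src _) hz hx e) ?_)
    rw [h'] at hx
    exact Germ.unit_mem_cls (Germ.src_src _) hz hx e
  continuous := continuous_dirProj
  isOpenMap := by
    intro O hO
    refine isOpen_iff_mem_nhds.2 ?_
    rintro _ ⟨p, hp, rfl⟩
    obtain ⟨a, ha⟩ := p.1.nonempty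
    obtain ⟨e, he, hs⟩ := exists_subset_of_isOpen hO hp ha
    filter_upwards [DirCoset.mem_nhds (D := T.dirProj p) (Germ.mem_base ha),
      DirCoset.mem_nhds (D := T.dirProj p) he] with E h₁ h₂
    exact ⟨germ E a h₁, hs (germ E a h₁) (Germ.mem_germ h₁) h₂, rfl⟩

end DirGerm

/-! ### The canonical representation on the directed coset bundle. -/

theorem dirRep_iff {a : S} {p : T.DirGerm} {D : T.DirCoset} :
    T.dirRep a p D ↔ T.dirProj p = D ∧ a ∈ p.1.cls := by
  constructor
  · rintro ⟨h, e⟩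
    refine ⟨Subtype.ext (congrArg Germ.base e), ?_⟩
    rw [e]
    exact Germ.mem_germ h
  · rintro ⟨rfl, h⟩
    exact ⟨Germ.mem_base h, Germ.ext_of_mem rfl h (Germ.mem_germ _)⟩

theorem relDom_dirRep (a : S) : relDom (T.dirRep a) = {D : T.DirCoset | a ∈ D.1.carrier} := by
  ext D
  constructor
  · rintro ⟨p, -, h, -⟩
    exact h
  · intro h
    exact ⟨DirGerm.germ D a h, trivial, h, rfl⟩

theorem isSliceSection_dirRep (a : S) : IsSliceSection T.dirProj (T.dirRep a) where
  unique _ _ _ := fun ⟨_, h⟩ ⟨_, k⟩ => Subtype.ext (h.trans k.symm)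
  isOpen_dom := relDom_dirRep (T := T) a ▸ DirCoset.isOpen_mem a
  isSlice_dom := relDom_dirRep (T := T) a ▸ DirCoset.isSlice a
  relContinuous O hO := by
    refine isOpen_iff_mem_nhds.2 ?_
    rintro D ⟨p, hp, h⟩
    obtain ⟨rfl, hc⟩ := dirRep_iff.1 h
    obtain ⟨e, he, hs⟩ := DirGerm.exists_subset_of_isOpen hO hp hc
    filter_upwards [DirCoset.mem_nhds (D := T.dirProj p) (Germ.mem_base hc),
      DirCoset.mem_nhds (D := T.dirProj p) he] with E h₁ h₂
    exact ⟨DirGerm.germ E a h₁, hs (DirGerm.germ E a h₁) (Germ.mem_germ h₁) h₂, h₁, rfl⟩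
  proj _ _ h := (dirRep_iff.1 h).1

/-- One inclusion is the factorisation of a directed coset containing ab; the other holds because
classes multiply. -/
theorem dirRep_mul (hZ : IsSymmetric (T.Z : Set S)) (a b : S) :
    T.dirRep (a * b) = sectionMul (T.dirRep a) (T.dirRep b) := by
  funext p D
  refine propext ⟨fun h => ?_, ?_⟩
  · obtain ⟨rfl, hc⟩ := dirRep_iff.1 h
    obtain ⟨A, B, hA, hB, ha, hb, e, e'⟩ := Coset.exists_mul_eq hZ p.2 (Germ.mem_base hc)
    refine ⟨DirGerm.germ ⟨A, hA⟩ a ha, ⟨A, hA⟩, DirGerm.germ ⟨B, hB⟩ b hb, ⟨B, hB⟩, ⟨ha, rfl⟩,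
      ⟨hb, rfl⟩, DirCoset.isMul_iff.2 ⟨e, e'⟩, DirGerm.isMul_iff.2 ?_⟩
    -- Composability in the total space reduces to composability of the bases, as one z in Z
    -- represents both units.
    have e₁ : src (Germ.germ A a ha) = rng (Germ.germ B b hb) := by
      obtain ⟨z, hz, x, hx, k⟩ := Germ.exists_fix A.src
      refine Germ.ext_of_mem e (Germ.unit_mem_cls (Germ.src_src _) hz hx k) ?_
      have e₂ : A.src = B.rng := e
      rw [e₂] at hx
      exact Germ.unit_mem_cls (src_rng B) hz hx k
    exact ⟨e₁, Germ.ext_of_mem e' (Germ.mul_mem _ (Germ.mem_germ ha) (Germ.mem_germ hb)) hc⟩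
  · rintro ⟨q, A, r, B, hq, hr, hm, hp⟩
    obtain ⟨rfl, hqc⟩ := dirRep_iff.1 hq
    obtain ⟨rfl, hrc⟩ := dirRep_iff.1 hr
    exact dirRep_iff.2 ⟨(DirGerm.isFunctor_dirProj _ _ _ hp).unique hm,
      Germ.mul_mem_of_isMul (DirGerm.isMul_iff.1 hp) hqc hrc⟩

theorem isBundleRep_dirRep (hZ : IsSymmetric (T.Z : Set S)) : T.IsBundleRep T.dirProj T.dirRep where
  isGroupoidBundle := DirGerm.isGroupoidBundle
  isSliceSection := isSliceSection_dirRep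
  map_mul := dirRep_mul hZ
  isEtaleRep := by
    simp only [relDom_dirRep]
    refine ⟨DirCoset.isEtale, DirCoset.isOpen_mem, DirCoset.isSlice, fun a b => ?_,
      fun D => D.1.nonempty, fun n hn D hD => mem_units.2 (DirCoset.src_eq_of_mem_N hn hD),
      fun D a ha => ?_⟩
    · ext D
      constructor
      · intro h
        obtain ⟨A, B, hA, hB, ha, hb, e⟩ := Coset.exists_mul_eq hZ D.2 h
        exact ⟨⟨A, hA⟩, ha, ⟨B, hB⟩, hb, DirCoset.isMul_iff.2 e⟩
      · rintro ⟨A, ha, B, hb, h⟩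
        obtain ⟨e, e'⟩ := DirCoset.isMul_iff.1 h
        exact Germ.mul_mem' e e' ha hb
    · obtain ⟨b, hb, k⟩ := Coset.exists_dom ha
      exact ⟨b, k, hb⟩

end StructuredSemigroup

/-! ### The Zakrzewski morphism attached to an étale representation. -/

namespace StructuredSemigroup
variable {S : Type*} [Semigroup S] {T : StructuredSemigroup S}

open ArrowGroupoid Topology

namespace IsEtaleRep

variable {G : Type*} [TopologicalSpace G] [ArrowGroupoid G] {η : S → Set G} {g h k : G}

theorem mem_mul (hη : T.IsEtaleRep η) {a b : S} (hg : g ∈ η a) (hh : h ∈ η b)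
    (e : IsMul g h k) : k ∈ η (a * b) := by
  rw [hη.map_mul]; exact ⟨g, hg, h, hh, e⟩

theorem mem_mul_of_mem_units (hη : T.IsEtaleRep η) (hh : h ∈ units G) {a b : S} (ha : h ∈ η a)
    (hb : h ∈ η b) : h ∈ η (a * b) :=
  hη.mem_mul ha hb hh

/-- Since η(n) consists of units, multiplying by it on the left only restricts η(a) to arrows with
range in η(n). -/
theorem of_N_mul (hη : T.IsEtaleRep η) {n a : S} (hn : n ∈ T.N) (hg : g ∈ η (n * a)) :
    g ∈ η a ∧ rng g ∈ η n := by
  rw [hη.map_mul] at hg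
  obtain ⟨x, hx, y, hy, e⟩ := hg
  obtain ⟨rfl, e'⟩ := e.eq_of_left_mem_units (hη.map_N n hn hx)
  exact ⟨hy, e' ▸ hx⟩

theorem mem_of_domVia (hη : T.IsEtaleRep η) {a s b : S} (k : T.DomVia s a b) (hg : g ∈ η a) :
    g ∈ η b ∧ rng g ∈ η (a * s) := by
  rw [← k.left] at hg
  exact hη.of_N_mul k.as_mem hg

theorem mem_of_dom (hη : T.IsEtaleRep η) {a b : S} (k : T.Dom a b) (hg : g ∈ η a) : g ∈ η b :=
  (hη.mem_of_domVia k.choose_spec hg).1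

/-- The range of g lies in η(as) = η(a)η(s), so it factors as xy. Here x has the same range as g and
both lie in the slice η(a), so x = g and y = g⁻¹. -/
theorem inv_mem (hη : T.IsEtaleRep η) {a s b : S} (k : T.DomVia s a b) (hg : g ∈ η a) :
    inv g ∈ η s := by
  obtain ⟨hb, hr⟩ := hη.mem_of_domVia k hg
  rw [hη.map_mul] at hr
  obtain ⟨x, hx, y, hy, e⟩ := hr
  have hxg : x = g := (hη.isSlice a).2 hx hg (by rw [← e.rng_eq, rng_rng])
  subst hxg
  rw [← (e.eq_inv_of_mem_units (rng_mem_units x)).1]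
  exact hy

theorem src_mem (hη : T.IsEtaleRep η) {a s b : S} (k : T.DomVia s a b) (hg : g ∈ η a) :
    src g ∈ η (s * a) :=
  hη.mem_mul (hη.inv_mem k hg) hg (isMul_inv_left g)

/-- The elements of `N` whose image contains `h`. -/
def normalAt (T : StructuredSemigroup S) (η : S → Set G) (h : G) : Set S := {n | n ∈ T.N ∧ h ∈ η n}

theorem exists_dom_normalAt (hη : T.IsEtaleRep η) {n : S} (hn : n ∈ normalAt T η h) :
    ∃ m ∈ normalAt T η h, T.Dom m n := by
  obtain ⟨b, hb, k⟩ := hη.locally_round h n hn.2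
  exact ⟨b, ⟨hb.mem_N hn.1, k⟩, hb⟩

theorem mul_mem_normalAt (hη : T.IsEtaleRep η) (hh : h ∈ units G) {m n : S}
    (hm : m ∈ normalAt T η h) (hn : n ∈ normalAt T η h) : m * n ∈ normalAt T η h :=
  ⟨T.N.mul_mem hm.1 hn.1, hη.mem_mul_of_mem_units hh hm.2 hn.2⟩

theorem subset_up_normalAt (hη : T.IsEtaleRep η) :
    normalAt T η h ⊆ T.up (normalAt T η h) := fun _ hn => hη.exists_dom_normalAt hn

/-- If n <_s c, then ns is again an element of N at h, and it is dominated by s via c. -/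
theorem dual_normalAt_subset (hη : T.IsEtaleRep η) (hh : h ∈ units G) :
    T.dual (normalAt T η h) ⊆ T.up (normalAt T η h) := by
  rintro s ⟨n, hn, c, k⟩
  have hr := (hη.mem_of_domVia k hn.2).2
  rw [rng_of_mem_units hh] at hr
  refine ⟨n * s, ⟨k.as_mem, hr⟩, c, .of_left ?_ ?_ k.sb_mem k.bs_mem⟩
  · rw [k.left]
  · rw [k.left]; exact hn.1

theorem up_normalAt_mul (hη : T.IsEtaleRep η) (hh : h ∈ units G) :
    T.up (normalAt T η h) * T.up (normalAt T η h) ⊆ T.up (normalAt T η h) :=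
  (up_mul_up _ _).trans (up_mono (by
    rintro _ ⟨m, hm, n, hn, rfl⟩; exact hη.mul_mem_normalAt hh hm hn))

theorem dual_up_normalAt_subset (hη : T.IsEtaleRep η) (hh : h ∈ units G) :
    T.dual (T.up (normalAt T η h)) ⊆ T.up (normalAt T η h) :=
  (dual_up _).trans ((up_mono (hη.dual_normalAt_subset hh)).trans (up_up _))

/-- The up-closure is closed under products and contains its dual, which gives the triple-product
condition. -/
theorem isCoset_up_normalAt (hη : T.IsEtaleRep η) (hh : h ∈ units G) :
    T.IsCoset (T.up (normalAt T η h)) := by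
  have hm := hη.up_normalAt_mul hh
  refine ⟨?_, (up_mono hη.subset_up_normalAt).antisymm (up_up _)⟩
  exact (Set.mul_subset_mul ((Set.mul_subset_mul subset_rfl (hη.dual_up_normalAt_subset hh)).trans
    hm) subset_rfl).trans hm

/-- Local roundness supplies b <_s a with h in η(b), and bs is then an element of N at h. -/
theorem nonempty_normalAt (hη : T.IsEtaleRep η) (hh : h ∈ units G) :
    (normalAt T η h).Nonempty := by
  obtain ⟨a, ha⟩ := hη.covers h
  obtain ⟨b, ⟨s, k⟩, hb⟩ := hη.locally_round h a ha
  have hr := (hη.mem_of_domVia k hb).2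
  rw [rng_of_mem_units hh] at hr
  exact ⟨_, k.as_mem, hr⟩

/-- With b < n and c < m the lower bound is bbc: it is below m because bb is in N, and below n by
`DomVia.sq_mul`. -/
theorem directed_up_normalAt (hη : T.IsEtaleRep η) (hh : h ∈ units G) :
    T.Directed (T.up (normalAt T η h)) := by
  rintro x ⟨n, hn, hx⟩ y ⟨m, hm, hy⟩
  obtain ⟨b, hb, s, k⟩ := hη.exists_dom_normalAt hn
  obtain ⟨c, hc, t, l⟩ := hη.exists_dom_normalAt hm
  exact ⟨b * b * c, hη.subset_up_normalAt
    (hη.mul_mem_normalAt hh (hη.mul_mem_normalAt hh hb hb) hc),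
    dom_trans ⟨s, k.sq_mul hn.1 hc.1⟩ hx, dom_trans ⟨t, l.N_mul (T.N.mul_mem hb.1 hb.1)⟩ hy⟩

/-- The directed unit coset of an étale representation at the source of `g`. -/
def unitAt (hη : T.IsEtaleRep η) (g : G) : T.DirCoset :=
  ⟨⟨T.up (normalAt T η (src g)), hη.isCoset_up_normalAt (src_mem_units g),
    (hη.nonempty_normalAt (src_mem_units g)).mono hη.subset_up_normalAt⟩,
    hη.directed_up_normalAt (src_mem_units g)⟩

theorem unitAt_congr (hη : T.IsEtaleRep η) (e : src g = src h) : hη.unitAt g = hη.unitAt h :=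
  Subtype.ext (Coset.ext (congrArg (fun x => T.up (normalAt T η x)) e))

theorem mem_unitAt (hη : T.IsEtaleRep η) {n : S} (hn : n ∈ T.N) (h : src g ∈ η n) :
    n ∈ (hη.unitAt g).1.carrier := hη.subset_up_normalAt ⟨hn, h⟩

theorem src_unitAt (hη : T.IsEtaleRep η) (g : G) : src (hη.unitAt g) = hη.unitAt g := by
  obtain ⟨n, hn⟩ := hη.nonempty_normalAt (src_mem_units g)
  exact DirCoset.src_eq_of_mem_N hn.1 (hη.subset_up_normalAt hn)

theorem src_mem_of_mem_unitAt (hη : T.IsEtaleRep η) {a : S} (ha : a ∈ (hη.unitAt g).1.carrier) :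
    src g ∈ η a := by
  obtain ⟨n, hn, h⟩ := ha
  exact hη.mem_of_dom h hn.2

/-- The universal Zakrzewski morphism: `D φ g` if `D` has the source determined by that of `g`,
and `g` lies in the image of an element of `D`. -/
def Classifies (hη : T.IsEtaleRep η) (D : T.DirCoset) (g : G) : Prop :=
  src D = hη.unitAt g ∧ ∃ a ∈ D.1.carrier, g ∈ η a

/-- Membership spreads from one a in D to all of D as in rigidity: for y < x in D, a'y is in the
source of D, so s(g) is in η(a'y). Hence g = g s(g) is in η(aa'y), and aa'y < x. -/
theorem Classifies.mem {hη : T.IsEtaleRep η} {D : T.DirCoset} (hD : hη.Classifies D g) {x : S}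
    (hx : x ∈ D.1.carrier) : g ∈ η x := by
  obtain ⟨hs, a, ha, hg⟩ := hD
  obtain ⟨d, hd, a', ha', k⟩ := D.1.isCoset.exists_dom ha
  obtain ⟨y, hy, t, l⟩ := Coset.exists_dom hx
  have h₁ : a' * y ∈ (src D).1.carrier := Coset.mul_mem_src ha' hy
  rw [hs] at h₁
  have h₂ := hη.mem_mul hg (hη.src_mem_of_mem_unitAt h₁) (isMul_src_right g)
  rw [← _root_.mul_assoc] at h₂
  exact hη.mem_of_dom ⟨t, l.N_mul (T.Z_le k.bs_mem)⟩ h₂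

/-- The coset is the translate by a of the unit coset at the source of g. -/
theorem exists_classifies (hη : T.IsEtaleRep η) {a : S} (ha : g ∈ η a) :
    ∃ D : T.DirCoset, a ∈ D.1.carrier ∧ hη.Classifies D g := by
  obtain ⟨d, ⟨a', k⟩, hd⟩ := hη.locally_round g a ha
  obtain ⟨D, h₁, h₂, -⟩ := DirCoset.exists_translate (hη.src_unitAt g) k.bs_mem k.sb_mem
    (hη.mem_unitAt k.sa_mem (hη.src_mem k hd))
    (by rw [_root_.mul_assoc, ← _root_.mul_assoc d, k.left])
  exact ⟨D, h₂, h₁, a, h₂, ha⟩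

/-- An n in N at r(g) is shrunk to nda', where d <_{a'} a in D. Its conjugate a'(nda')a is in N by
trinormality and has s(g) in its image, so it lies in the source of D. Conjugating back puts nda' in
the range of D, below everything that dominates n. -/
theorem Classifies.unitAt_inv_subset {hη : T.IsEtaleRep η} {D : T.DirCoset}
    (hD : hη.Classifies D g) :
    (hη.unitAt (inv g)).1.carrier ⊆ (rng D).1.carrier := by
  rintro x ⟨n, ⟨hn, hg⟩, hx⟩
  rw [src_inv] at hg
  obtain ⟨a, ha⟩ := D.1.nonempty
  obtain ⟨d, hd, a', ha', k⟩ := D.1.isCoset.exists_dom ha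
  have hdg := hD.mem hd
  have hr := (hη.mem_of_domVia k hdg).2
  have h₁ : n * (d * a') ∈ T.N := T.N.mul_mem hn k.as_mem
  have h₂ : rng g ∈ η (n * (d * a')) := hη.mem_mul_of_mem_units (rng_mem_units g) hg hr
  have e₁ : n * (d * a') * a * a' = n * (d * a') := by
    rw [_root_.mul_assoc _ a, T.Z_comm _ k.bs_mem _ h₁ |>.symm,
      ← _root_.mul_assoc, T.Z_comm _ k.bs_mem _ hn, _root_.mul_assoc n, ← _root_.mul_assoc (a * a'),
      k.right]
  have e₂ : a * a' * (n * (d * a')) = n * (d * a') := by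
    rw [T.Z_comm _ k.bs_mem _ h₁, ← _root_.mul_assoc, e₁]
  have h₃ := T.trinormal a a' _ h₁ e₂ e₁ k.bs_mem k.sb_mem
  have h₄ : src g ∈ η (a' * (n * (d * a')) * a) :=
    hη.mem_mul (hη.mem_mul (hη.inv_mem k hdg) h₂ (by
      have := isMul_src_right (inv g); rwa [src_inv] at this)) (hD.mem ha) (isMul_inv_left g)
  have h₅ : a' * (n * (d * a')) * a ∈ (src D).1.carrier := by
    rw [hD.1]; exact hη.mem_unitAt h₃ h₄
  have h₆ := Coset.mul_mem_rng (Coset.mul_mem_of_src ha h₅) ha'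
  have e₃ : a * (a' * (n * (d * a')) * a) * a' = n * (d * a') := by
    calc _ = a * a' * (n * (d * a')) * a * a' := by simp only [_root_.mul_assoc]
      _ = _ := by rw [e₂, e₁]
  rw [e₃] at h₆
  obtain ⟨s, l⟩ := hx
  exact Coset.mem_of_dom h₆ ⟨s, l.mul_N k.as_mem⟩

/-- Equality comes from using the inclusion twice. Let B be the translate by a' of the unit coset at
r(g), so B classifies g⁻¹. The inclusion for D gives B ⊆ D* by rigidity, so the range of B is inside
the source of D; the inclusion for B gives the converse. Hence B and D* have the same range and
share a', so they are equal. -/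
theorem Classifies.rng_eq {hη : T.IsEtaleRep η} {D : T.DirCoset} (hD : hη.Classifies D g) :
    rng D = hη.unitAt (inv g) := by
  obtain ⟨a, ha⟩ := D.1.nonempty
  obtain ⟨d, hd, a', ha', k⟩ := D.1.isCoset.exists_dom ha
  have hdg := hD.mem hd
  have ha'g := hη.inv_mem k hdg
  have hr := (hη.mem_of_domVia k hdg).2
  rw [← src_inv] at hr
  have hm : d * a' * (a * a') = d * a' := by rw [← _root_.mul_assoc, k.left]
  obtain ⟨B, hB, haB, -⟩ := DirCoset.exists_translate (hη.src_unitAt (inv g)) k.sb_mem k.bs_mem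
    (hη.mem_unitAt k.as_mem hr) hm
  have hBg : hη.Classifies B (inv g) := ⟨hB, a', haB, ha'g⟩
  have h₁ := hBg.unitAt_inv_subset
  rw [ArrowGroupoid.inv_inv, ← hD.1] at h₁
  have h₂ := hD.unitAt_inv_subset
  rw [← hB, ← src_inv] at h₂
  have ha'D : a' ∈ (inv D).1.carrier := ha'
  have h₃ : B.1.carrier ⊆ (inv D).1.carrier := Coset.subset_of_src haB ha'D h₂
  have h₄ : (rng B).1.carrier ⊆ (src D).1.carrier := by
    rw [← rng_inv]
    exact up_mono (Set.mul_subset_mul h₃ (dual_mono h₃))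
  have h₅ : rng B = rng (inv D) := by
    rw [rng_inv]; exact Subtype.ext (Coset.ext (h₄.antisymm h₁))
  rw [← hB, DirCoset.eq_of_rng haB ha'D h₅, src_inv]

theorem Classifies.inv {hη : T.IsEtaleRep η} {D : T.DirCoset} (hD : hη.Classifies D g) :
    hη.Classifies (inv D) (ArrowGroupoid.inv g) := by
  refine ⟨by rw [src_inv, hD.rng_eq], ?_⟩
  obtain ⟨a, ha⟩ := D.1.nonempty
  obtain ⟨d, hd, a', ha', k⟩ := D.1.isCoset.exists_dom ha
  exact ⟨a', ha', hη.inv_mem k (hD.mem hd)⟩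

theorem Classifies.mul {hη : T.IsEtaleRep η} {D E : T.DirCoset} (hD : hη.Classifies D g)
    (hE : hη.Classifies E h) (e : src g = rng h) :
    ∃ e' : src D = rng E, hη.Classifies (mul D E e') (mul g h e) := by
  have e' : src D = rng E := by
    rw [hD.1, hE.rng_eq]
    exact hη.unitAt_congr (by rw [src_inv, e])
  obtain ⟨a, ha, hga⟩ := hD.2
  obtain ⟨b, hb, hhb⟩ := hE.2
  refine ⟨e', ?_, a * b, Germ.mul_mem' (congrArg Subtype.val e') rfl ha hb,
    hη.mem_mul hga hhb ⟨e, rfl⟩⟩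
  rw [src_mul, hE.1]
  exact hη.unitAt_congr (src_mul g h e).symm

theorem isZakrzewski_classifies (hη : T.IsEtaleRep η) : IsZakrzewski hη.Classifies where
  isFunctorial := ⟨fun _ _ h => h.inv, fun _ _ _ _ h k => h.mul k⟩
  isStarBijective := by
    intro D u hu hD
    obtain ⟨a, ha⟩ := D.1.nonempty
    obtain ⟨d, hd, a', ha', k⟩ := D.1.isCoset.exists_dom ha
    -- As da' is in the range of D, u lies in η(d)η(a'); being a unit, it is xx⁻¹ with x in η(d).
    -- This x is the required arrow, unique because η(d) is a slice.
    have h₁ := hD.mem (Coset.mul_mem_rng hd ha')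
    rw [hη.map_mul] at h₁
    obtain ⟨x, hx, y, hy, e⟩ := h₁
    obtain ⟨rfl, rfl⟩ := e.eq_inv_of_mem_units hu
    have h₂ : hη.Classifies (ArrowGroupoid.inv D) (ArrowGroupoid.inv x) := by
      refine ⟨?_, a', ha', hy⟩
      rw [src_inv, ← src_rng D, hD.1]
      exact hη.unitAt_congr (by rw [src_rng, src_inv])
    have h₃ := h₂.inv
    rw [ArrowGroupoid.inv_inv, ArrowGroupoid.inv_inv] at h₃
    refine ⟨x, ⟨rfl, h₃⟩, fun i hi => ?_⟩
    exact (hη.isSlice d).2 (hi.2.mem hd) hx hi.1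
  relContinuous := by
    intro O hO
    refine isOpen_iff_mem_nhds.2 ?_
    rintro g ⟨D, hD, hg⟩
    obtain ⟨a, ha, hs⟩ := DirCoset.exists_subset_of_isOpen hO hD
    filter_upwards [(hη.isOpen a).mem_nhds (hg.mem ha)] with x hx
    obtain ⟨E, hE, hEx⟩ := hη.exists_classifies hx
    exact ⟨E, hs E hE, hEx⟩

/-- `φ = Classifies` is the only Zakrzewski morphism for which `η a` is the preimage of the
directed cosets containing `a`. -/
theorem eq_classifies (hη : T.IsEtaleRep η) {ψ : T.DirCoset → G → Prop} (hψ : IsFunctorial ψ)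
    (h₁ : ∀ D g a, ψ D g → a ∈ D.1.carrier → g ∈ η a)
    (h₂ : ∀ g a, g ∈ η a → ∃ D : T.DirCoset, a ∈ D.1.carrier ∧ ψ D g) : ψ = hη.Classifies := by
  have hsrc : ∀ D g, ψ D g → ψ (src D) (src g) := by
    intro D g h
    obtain ⟨e, h'⟩ := hψ.mul _ _ _ _ (hψ.inv _ _ h) h (src_inv g)
    rwa [inv_mul, inv_mul] at h'
  -- The source of a coset related to g is forced to be the unit coset at s(g).
  have key : ∀ D g, ψ D g → src D = hη.unitAt g := by
    intro D g h
    have hs := hsrc D g h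
    refine Subtype.ext (Coset.ext (Set.Subset.antisymm (fun x hx => ?_) ?_))
    -- The source of D contains some z in Z. By directedness x and z have a common lower bound in
    -- it, which lies in N because it is below z.
    · obtain ⟨z, hz, y, hy, e⟩ := Germ.exists_fix (src D).1
      have hzD := Germ.unit_mem (congrArg Subtype.val (src_src D)) hz hy e
      obtain ⟨n, hn, k₁, k₂⟩ := (src D).2 x hx z hzD
      exact ⟨n, ⟨k₂.mem_N (T.Z_le hz), h₁ _ _ _ hs hn⟩, k₁⟩
    · rintro x ⟨n, ⟨hn, hg⟩, hx⟩
      -- Both E, a unit containing n, and the source of D are related to s(g). Functoriality makes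
      -- them composable, hence equal.
      obtain ⟨E, hE, hEg⟩ := h₂ _ _ hg
      obtain ⟨e, -⟩ := hψ.mul _ _ _ _ hEg hs (by rw [src_src, rng_src])
      rw [DirCoset.src_eq_of_mem_N hn hE, rng_src] at e
      rw [← e]
      exact Coset.mem_of_dom hE hx
  funext D g
  refine propext ⟨fun h => ?_, fun h => ?_⟩
  · obtain ⟨a, ha⟩ := D.1.nonempty
    exact ⟨key D g h, a, ha, h₁ D g a h ha⟩
  -- Some E containing a is related to g; it shares a and its source with D, so rigidity gives E =
  -- D.
  · obtain ⟨hs, a, ha, hg⟩ := h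
    obtain ⟨E, hE, hEg⟩ := h₂ g a hg
    rwa [DirCoset.eq_of_src ha hE (hs.trans (key E g hEg).symm)]

end IsEtaleRep

/-! ### The universal Zakrzewski–Pierce morphism and its uniqueness. -/

namespace IsBundleRep

variable {F : Type*} {G : Type*} [TopologicalSpace F] [ArrowGroupoid F] [TopologicalSpace G]
  [ArrowGroupoid G] {π : F → G} {θ : S → F → G → Prop} {f f' x : F} {g h k : G}

/-- Values over composable arrows are composable: the source of f and the range of f' have the same
image under π, which is injective on units. -/
theorem rel_mul (hθ : T.IsBundleRep π θ) {a b : S} (hf : θ a f g) (hf' : θ b f' h)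
    (e : IsMul g h k) : ∃ x, IsMul f f' x ∧ θ (a * b) x k := by
  obtain ⟨x, hx⟩ : ∃ x, IsMul f f' x := by
    have p₁ := (hθ.isSliceSection a).proj _ _ hf
    have p₂ := (hθ.isSliceSection b).proj _ _ hf'
    have hF := hθ.isGroupoidBundle.isFunctor
    have h₁ : π (src f) = src g := by
      have := hF _ _ _ (isMul_src_right f)
      rw [p₁] at this
      exact this.left_cancel (isMul_src_right g)
    have h₂ : π (rng f') = rng h := by
      have := hF _ _ _ (isMul_rng_left f')
      rw [p₂] at this
      exact this.right_cancel (isMul_rng_left h)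
    exact ⟨_, hθ.isGroupoidBundle.injOn_units (src_mem_units f) (rng_mem_units f')
      (by rw [h₁, h₂, e.choose]), rfl⟩
  refine ⟨x, hx, ?_⟩
  rw [hθ.map_mul]
  exact ⟨f, g, f', h, hf, hf', e, hx⟩

theorem exists_value (hθ : T.IsBundleRep π θ) {D : T.DirCoset} (hD : hθ.isEtaleRep.Classifies D g)
    {a : S} (ha : a ∈ D.1.carrier) : ∃ f, θ a f g := by
  obtain ⟨f, -, hf⟩ := hD.mem ha
  exact ⟨f, hf⟩

/-- With sat = sbt for s, t in D*, and x, y the values of θ(s), θ(t) at g⁻¹, both xfy and xf'y are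
the value of θ(sat) at g⁻¹. Cancel x and y. -/
theorem eq_of_mem_cls (hθ : T.IsBundleRep π θ) {p : T.DirGerm}
    (hp : hθ.isEtaleRep.Classifies (T.dirProj p) g) {a b : S} (ha : a ∈ p.1.cls)
    (hb : b ∈ p.1.cls) (hf : θ a f g) (hf' : θ b f' g) : f = f' := by
  obtain ⟨s, hs, t, ht, e⟩ := Germ.rel hb ha
  obtain ⟨x, hx⟩ := hθ.exists_value hp.inv hs
  obtain ⟨y, hy⟩ := hθ.exists_value hp.inv ht
  obtain ⟨u, hu, hu'⟩ := hθ.rel_mul hx hf (isMul_inv_left g)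
  obtain ⟨v, hv, hv'⟩ := hθ.rel_mul hx hf' (isMul_inv_left g)
  have e₁ : IsMul (src g) (inv g) (inv g) := by
    have := isMul_rng_left (inv g)
    rwa [rng_inv] at this
  obtain ⟨w, hw, hw'⟩ := hθ.rel_mul hu' hy e₁
  obtain ⟨z, hz, hz'⟩ := hθ.rel_mul hv' hy e₁
  rw [e] at hw'
  obtain rfl := (hθ.isSliceSection _).unique _ _ _ hw' hz'
  obtain rfl := hw.right_cancel hz
  exact hu.left_cancel hv

theorem exists_germ_value (hθ : T.IsBundleRep π θ) {p : T.DirGerm}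
    (hp : hθ.isEtaleRep.Classifies (T.dirProj p) g) : ∃ f, ∀ a ∈ p.1.cls, θ a f g := by
  obtain ⟨a, ha⟩ := p.1.nonempty
  obtain ⟨f, hf⟩ := hθ.exists_value hp (Germ.mem_base ha)
  refine ⟨f, fun b hb => ?_⟩
  obtain ⟨f', hf'⟩ := hθ.exists_value hp (Germ.mem_base hb)
  rwa [hθ.eq_of_mem_cls hp ha hb hf hf']

/-- The universal functor `τ ([a, D], g) = θ a g`. -/
noncomputable def value (hθ : T.IsBundleRep π θ)
    (p : {p : T.DirGerm × G // hθ.isEtaleRep.Classifies (T.dirProj p.1) p.2}) : F :=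
  (hθ.exists_germ_value p.2).choose

theorem rel_value (hθ : T.IsBundleRep π θ)
    (p : {p : T.DirGerm × G // hθ.isEtaleRep.Classifies (T.dirProj p.1) p.2}) {a : S}
    (ha : a ∈ p.1.1.1.cls) : θ a (hθ.value p) p.1.2 :=
  (hθ.exists_germ_value p.2).choose_spec a ha

/-- The Zakrzewski–Pierce morphism from the directed coset bundle determined by a bundle
representation. -/
noncomputable def zpMorphism (hθ : T.IsBundleRep π θ) : ZPMorphism T.dirProj π where
  rel := hθ.isEtaleRep.Classifies
  map := hθ.value
  isZakrzewski := hθ.isEtaleRep.isZakrzewski_classifies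
  continuous_map := by
    refine continuous_def.2 fun O hO => isOpen_iff_mem_nhds.2 fun p hp => ?_
    -- As long as `a` stays in the class of the germ, the map is the section θ(a), whose continuity
    -- is known.
    obtain ⟨a, ha⟩ := p.1.1.1.nonempty
    have c₁ := (continuous_fst.comp continuous_subtype_val).continuousAt.preimage_mem_nhds (x := p)
      (DirGerm.cls_mem_nhds ha)
    have c₂ := (continuous_snd.comp continuous_subtype_val).continuousAt.preimage_mem_nhds (x := p)
      (((hθ.isSliceSection a).relContinuous O hO).mem_nhds ⟨_, hp, hθ.rel_value p ha⟩)
    filter_upwards [c₁, c₂] with q h₁ h₂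
    obtain ⟨f, hf, hfq⟩ := h₂
    have := (hθ.isSliceSection a).unique _ _ _ (hθ.rel_value q h₁) hfq
    change hθ.value q ∈ O
    rwa [this]
  map_functor := by
    intro p q r h₁ h₂
    obtain ⟨a, ha⟩ := p.1.1.1.nonempty
    obtain ⟨b, hb⟩ := q.1.1.1.nonempty
    -- The product of the values of θ(a) and θ(b) is the value of θ(ab), and ab represents the
    -- product germ.
    obtain ⟨x, hx, hx'⟩ := hθ.rel_mul (hθ.rel_value p ha) (hθ.rel_value q hb) h₂
    rwa [(hθ.isSliceSection _).unique _ _ _ (hθ.rel_value r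
      (Germ.mul_mem_of_isMul (DirGerm.isMul_iff.1 h₁) ha hb)) hx']
  proj_map p := by
    obtain ⟨a, ha⟩ := p.1.1.1.nonempty
    exact (hθ.isSliceSection a).proj _ _ (hθ.rel_value p ha)

theorem eq_transport (hθ : T.IsBundleRep π θ) (a : S) :
    θ a = hθ.zpMorphism.transport (T.dirRep a) := by
  funext f g
  refine propext ⟨fun h => ?_, ?_⟩
  · obtain ⟨D, ha, hD⟩ := hθ.isEtaleRep.exists_classifies (g := g) (a := a) ⟨f, trivial, h⟩
    have ha' : a ∈ (DirGerm.germ D a ha).1.cls := Germ.mem_germ ha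
    exact ⟨DirGerm.germ D a ha, hD, ⟨D, dirRep_iff.2 ⟨rfl, ha'⟩, hD⟩,
      (hθ.isSliceSection a).unique _ _ _ h
        (hθ.rel_value ⟨(DirGerm.germ D a ha, g), hD⟩ ha')⟩
  · rintro ⟨p, hp, ⟨D, hD, -⟩, rfl⟩
    exact hθ.rel_value ⟨(p, g), hp⟩ (dirRep_iff.1 hD).2

/-- The equation for θ(a) prescribes the map at every germ represented by `a`, so only the relation
has to be identified; this is `IsEtaleRep.eq_classifies`. -/
theorem eq_zpMorphism (hθ : T.IsBundleRep π θ) (m : ZPMorphism T.dirProj π)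
    (hm : ∀ a, θ a = m.transport (T.dirRep a)) : m = hθ.zpMorphism := by
  have val : ∀ (p : T.DirGerm) (g : G) (hp : m.rel (T.dirProj p) g) (a : S), a ∈ p.1.cls →
      θ a (m.map ⟨(p, g), hp⟩) g := by
    intro p g hp a ha
    rw [hm]
    exact ⟨p, hp, ⟨_, dirRep_iff.2 ⟨rfl, ha⟩, hp⟩, rfl⟩
  have hrel : m.rel = hθ.zpMorphism.rel := by
    refine hθ.isEtaleRep.eq_classifies m.isZakrzewski.isFunctorial (fun D g a hD ha => ?_)
      fun g a hg => ?_
    · exact ⟨_, trivial, val (DirGerm.germ D a ha) g hD a (Germ.mem_germ ha)⟩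
    · obtain ⟨f, -, hf⟩ := hg
      rw [hm] at hf
      obtain ⟨p, -, ⟨D, hD, hDg⟩, -⟩ := hf
      exact ⟨D, hD.choose, hDg⟩
  -- The domain of the map depends on the relation, so the relations are identified before the maps
  -- are compared.
  obtain ⟨rel, map, h₁, h₂, h₃, h₄⟩ := m
  obtain rfl : rel = hθ.isEtaleRep.Classifies := hrel
  refine ZPMorphism.ext rfl (heq_of_eq (funext fun p => ?_))
  obtain ⟨a, ha⟩ := p.1.1.1.nonempty
  exact (hθ.isSliceSection a).unique _ _ _ (val p.1.1 p.1.2 p.2 a ha) (hθ.rel_value p ha)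

end IsBundleRep

end StructuredSemigroup

theorem theorem11p18 {S : Type u} [Semigroup S] (T : StructuredSemigroup S)
    (hZ : StructuredSemigroup.IsSymmetric (T.Z : Set S)) :
    T.IsBundleRep T.dirProj T.dirRep ∧
      StructuredSemigroup.IsZakrzewskiUniversal.{v, w} T T.dirProj T.dirRep := by
  refine ⟨StructuredSemigroup.isBundleRep_dirRep hZ, ?_⟩
  intro F G _ _ _ _ π θ hθ
  exact ⟨hθ.zpMorphism, hθ.eq_transport, hθ.eq_zpMorphism⟩
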